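/- Let $\mathfrak H$ be a complex Hilbert space and $J$ a bounded operator on $\mathfrak H$ with $J=J^*$, $J^2=I$, $J\neq\pm I$; put $[x,y]=(Jx,y)$ and $\mathfrak H_\pm=\frac12(I\pm J)\mathfrak H$. Let $S$ be a closed densely defined symmetric operator in $\mathfrak H$ with $SJ=JS$, and assume that the operators $S_\pm=S\upharpoonright_{\mathfrak H_\pm}$ in $\mathfrak H_\pm$ both have deficiency indices $\langle 1,1\rangle$. Let $\Sigma_J$ be the set of all extensions of $S$ that are $J$-self-adjoint, i.e. self-adjoint with respect to $[\cdot,\cdot]$, and put $\mathfrak N_\mu=\ker(S^*-\mu I)$. Choose vectors of equal norm $e_{++},e_{+-},e_{-+},e_{--}$ with $\ker(S_+^*-iI)=\mathrm{span}\{e_{++}\}$, $\ker(S_-^*-iI)=\mathrm{span}\{e_{+-}\}$, $\ker(S_+^*+iI)=\mathrm{span}\{e_{-+}\}$, $\ker(S_-^*+iI)=\mathrm{span}\{e_{--}\}$. For a unitary $2\times2$ matrix $U=(U_{jk})$ let $A_U$ be the restriction of $S^*$ to $\mathcal D(S)\dotplus\mathrm{span}\{d_1,d_2\}$, where $$d_1=e_{++}+U_{11}e_{+-}+U_{12}e_{-+},\qquad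 d_2=e_{--}+U_{21}e_{+-}+U_{22}e_{-+}.$$ For $\mu\in\mathbb C_+$ (the open upper half plane) let $A_\mu=S^*\upharpoonright_{\mathcal D(S)\dotplus\mathfrak N_\mu}$ and let $\mathsf{Sh}(\mu)=(A_\mu-iI)(A_\mu+iI)^{-1}\upharpoonright_{\mathfrak N_i}$ be the characteristic function of $S$. Define $s_\pm:\mathbb C_+\to\mathbb C$ by $\mathsf{Sh}(\mu)e_{++}=s_+(\mu)e_{-+}$ and $\mathsf{Sh}(\mu)e_{+-}=s_-(\mu)e_{--}$. Assume that $s_+\approx s_-$, i.e. there is $\alpha\in\mathbb R$ with $e^{i\alpha}s_+(\mu)=s_-(\mu)$ for all $\mu\in\mathbb C_+$. Then $U\mapsto A_U$ is a bijection from the unitary $2\times 2$ matrices onto $\Sigma_J$, and the operators in $\Sigma_J$ with empty resolvent set are described as follows. 1. If $\mathsf{Sh}\not\equiv0$ on $\mathbb C_+$, then there is exactly one $\varphi\in[0,\pi)$ such that $$e^{2i\varphi}s_-(\mu)=s_+(\mu)\quad\text{for all }\mu\in\mathbb C_+,\qquad(*)$$ and for every real $\varphi$ satisfying $(*)$ and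 every unitary $U$, the resolvent set of $A_U$ is empty if and only if $$U=e^{i\varphi}\begin{pmatrix}e^{i\gamma}&0\\0&e^{-i\gamma}\end{pmatrix}\qquad(**)$$ for some $\gamma\in[0,2\pi)$. 2. If $\mathsf{Sh}\equiv0$ on $\mathbb C_+$, then for every unitary $U$ the resolvent set of $A_U$ is empty if and only if $U$ has the form $(**)$ for some $\varphi,\gamma\in[0,2\pi)$. -/

import Mathlib

noncomputable section

namespace JExt

open Complex

variable {H : Type*} [NormedAddCommGroup H] [InnerProductSpace ℂ H]

/-- The resolvent set of an (unbounded) operator `A`: all `μ` for which `A - μ` maps `D(A)`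
bijectively onto the whole space and has a bounded inverse `R`. -/
def resolventSet (A : H →ₗ.[ℂ] H) : Set ℂ :=
  {μ | ∃ R : H →L[ℂ] H, (∀ y, ∃ h : R y ∈ A.domain, A ⟨R y, h⟩ - μ • R y = y) ∧
    ∀ x : A.domain, R (A x - μ • (x : H)) = x}

/-- A non-trivial fundamental symmetry: `J = J*`, `J² = I`, `J ≠ I` and `J ≠ -I`. -/
structure IsFundamentalSymmetry [CompleteSpace H] (J : H →L[ℂ] H) : Prop where
  selfAdjoint : IsSelfAdjoint J
  sq : J * J = 1
  ne_one : J ≠ 1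
  ne_neg_one : J ≠ -1

/-- `A C = C A` for an unbounded operator `A` and a bounded operator `C`, with equality
of the natural domains `{x | C x ∈ D(A)}` and `D(A)` included. -/
def CommutesWith (A : H →ₗ.[ℂ] H) (C : H →L[ℂ] H) : Prop :=
  (∀ x, C x ∈ A.domain ↔ x ∈ A.domain) ∧
    ∀ (x : A.domain) (h : C x ∈ A.domain), A ⟨C x, h⟩ = C (A x)

/-- `A` is self-adjoint for the indefinite inner product `[x, y] = (J x, y)`: it is densely
defined, and `x ∈ D(A)`, `A x = y` holds exactly when `[A u, x] = [u, y]` for all `u ∈ D(A)`. -/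
def IsJSelfAdjoint (J : H →L[ℂ] H) (A : H →ₗ.[ℂ] H) : Prop :=
  Dense (A.domain : Set H) ∧
    ∀ x y : H, (x, y) ∈ A.graph ↔ ∀ u : A.domain, inner ℂ (J (A u)) x = inner ℂ (J u) y

/-- `Σ_J`: the set of all `J`-self-adjoint extensions of `S`. -/
def jSelfAdjointExtensions (J : H →L[ℂ] H) (S : H →ₗ.[ℂ] H) : Set (H →ₗ.[ℂ] H) :=
  {A | S ≤ A ∧ IsJSelfAdjoint J A}

/-- The subspace `H₊` of the fundamental decomposition, as the eigenspace of `J` for `1`. -/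
def posSubspace (J : H →L[ℂ] H) : Submodule ℂ H := (J - 1).ker

/-- The subspace `H₋` of the fundamental decomposition, as the eigenspace of `J` for `-1`. -/
def negSubspace (J : H →L[ℂ] H) : Submodule ℂ H := (J + 1).ker

/-- `H₊` is the range of the projector `P₊ = (I + J) / 2`. -/
theorem posSubspace_eq_range {J : H →L[ℂ] H} (hJ : J * J = 1) :
    posSubspace J = ((1 / 2 : ℂ) • (1 + J)).range := by
  have hJ' : ∀ x, J (J x) = x := fun x => by
    simpa using congrArg (fun T : H →L[ℂ] H => T x) hJ
  ext x
  simp only [posSubspace, LinearMap.mem_ker, LinearMap.mem_range, ContinuousLinearMap.coe_coe]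
  constructor
  · intro h
    have h1 : J x = x := sub_eq_zero.1 (by simpa using h)
    refine ⟨x, ?_⟩
    simp only [_root_.smul_apply, _root_.add_apply,
      one_apply_eq_self, h1]
    module
  · rintro ⟨y, rfl⟩
    simp [hJ', add_comm]

/-- `H₋` is the range of the projector `P₋ = (I - J) / 2`. -/
theorem negSubspace_eq_range {J : H →L[ℂ] H} (hJ : J * J = 1) :
    negSubspace J = ((1 / 2 : ℂ) • (1 - J)).range := by
  have hJ' : ∀ x, J (J x) = x := fun x => by
    simpa using congrArg (fun T : H →L[ℂ] H => T x) hJ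
  ext x
  simp only [negSubspace, LinearMap.mem_ker, LinearMap.mem_range, ContinuousLinearMap.coe_coe]
  constructor
  · intro h
    have h1 : J x = -x := eq_neg_of_add_eq_zero_left (by simpa using h)
    refine ⟨x, ?_⟩
    simp only [_root_.smul_apply, _root_.sub_apply,
      one_apply_eq_self, h1]
    module
  · rintro ⟨y, rfl⟩
    simp only [_root_.add_apply, _root_.smul_apply,
      _root_.sub_apply, one_apply_eq_self, map_smul, map_sub, hJ']
    module

instance [CompleteSpace H] (J : H →L[ℂ] H) : CompleteSpace (posSubspace J) :=
  (J - 1).isClosed_ker.completeSpace_coe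

instance [CompleteSpace H] (J : H →L[ℂ] H) : CompleteSpace (negSubspace J) :=
  (J + 1).isClosed_ker.completeSpace_coe

/-- The part of `A` in the subspace `K`, as an operator in `K`: `x ↦ A x`
for those `x ∈ K ∩ D(A)` with `A x ∈ K`. -/
def part (A : H →ₗ.[ℂ] H) (K : Submodule ℂ H) : K →ₗ.[ℂ] K :=
  (A.graph.comap (K.subtype.prodMap K.subtype)).toLinearPMap

theorem mem_graph_part (A : H →ₗ.[ℂ] H) (K : Submodule ℂ H) (x y : K) :
    (x, y) ∈ (part A K).graph ↔ ((x : H), (y : H)) ∈ A.graph := by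
  rw [part, Submodule.toLinearPMap_graph_eq]
  · simp
  · rintro ⟨a, b⟩ h (rfl : a = 0)
    have : ((0 : H), (b : H)) ∈ A.graph := by simpa using h
    exact Subtype.ext (A.graph_fst_eq_zero_snd this rfl)

variable [CompleteSpace H]

/-- The defect subspace `N_μ(T) = ker (T* - μ I)`. -/
def defect (T : H →ₗ.[ℂ] H) (μ : ℂ) : Submodule ℂ H :=
  T.adjoint.graph.comap (LinearMap.id.prod (μ • LinearMap.id))

/-- `T` has the finite deficiency indices `⟨m, n⟩`. -/
def HasDeficiencyIndices (T : H →ₗ.[ℂ] H) (m n : ℕ) : Prop :=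
  Module.rank ℂ (defect T I) = m ∧ Module.rank ℂ (defect T (-I)) = n

/-- The extension `A_μ = S* ↾ (D(S) + N_μ)` of `S`. -/
def strausExtension (S : H →ₗ.[ℂ] H) (μ : ℂ) : H →ₗ.[ℂ] H :=
  S.adjoint.domRestrict (S.domain ⊔ defect S μ)

/-- The Cayley transform `(A - i I) (A + i I)⁻¹`, through its graph
`{(A u + i u, A u - i u) | u ∈ D(A)}`. -/
def cayley (A : H →ₗ.[ℂ] H) : H →ₗ.[ℂ] H :=
  (A.graph.map ((LinearMap.snd ℂ H H + I • LinearMap.fst ℂ H H).prod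
    (LinearMap.snd ℂ H H - I • LinearMap.fst ℂ H H))).toLinearPMap

/-- The characteristic function `Sh(μ) = (A_μ - i I) (A_μ + i I)⁻¹ ↾ N_i` of `S`,
for `μ` in the open upper half plane. -/
def Sh (S : H →ₗ.[ℂ] H) (μ : ℂ) : H →ₗ.[ℂ] H :=
  (cayley (strausExtension S μ)).domRestrict (defect S I)

/-- `Sh ≡ 0` on the open upper half plane. -/
def ShIsZero (S : H →ₗ.[ℂ] H) : Prop :=
  ∀ μ : ℂ, 0 < μ.im → ∀ x : (Sh S μ).domain, Sh S μ x = 0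

/-- Generators `e₊₊, e₊₋, e₋₊, e₋₋`, of equal norms, of the one-dimensional defect subspaces
`N_i(S₊), N_i(S₋), N_{-i}(S₊), N_{-i}(S₋)` of the parts `S₊, S₋` of `S` in `H₊, H₋`.
(They form an orthogonal basis of `N_i ∔ N_{-i}` for the inner product
`2 [(x_i, y_i) + (x_{-i}, y_{-i})]`, whose norm is `√2 ‖x‖` on each of `N_i` and `N_{-i}`.) -/
structure DefectBasis (J : H →L[ℂ] H) (S : H →ₗ.[ℂ] H) where
  (pp pm mp mm : H)
  span_pp : (defect (part S (posSubspace J)) I).map (posSubspace J).subtype = ℂ ∙ pp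
  span_pm : (defect (part S (negSubspace J)) I).map (negSubspace J).subtype = ℂ ∙ pm
  span_mp : (defect (part S (posSubspace J)) (-I)).map (posSubspace J).subtype = ℂ ∙ mp
  span_mm : (defect (part S (negSubspace J)) (-I)).map (negSubspace J).subtype = ℂ ∙ mm
  norm_pm : ‖pm‖ = ‖pp‖
  norm_mp : ‖mp‖ = ‖pp‖
  norm_mm : ‖mm‖ = ‖pp‖

open Classical in
/-- The number `c` with `T e = c e'` (and `0` if there is none). -/
def ratio (T : H →ₗ.[ℂ] H) (e e' : H) : ℂ :=
  if h : ∃ c : ℂ, (e, c • e') ∈ T.graph then h.choose else 0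

namespace DefectBasis

variable {J : H →L[ℂ] H} {S : H →ₗ.[ℂ] H} (e : DefectBasis J S)

/-- The function `s₊`, determined by `Sh(μ) e₊₊ = s₊(μ) e₋₊`. -/
def sPlus (μ : ℂ) : ℂ := ratio (Sh S μ) e.pp e.mp

/-- The function `s₋`, determined by `Sh(μ) e₊₋ = s₋(μ) e₋₋`. -/
def sMinus (μ : ℂ) : ℂ := ratio (Sh S μ) e.pm e.mm

/-- `s₊ ≈ s₋`: equality on the open upper half plane up to a unimodular constant. -/
def SApprox : Prop :=
  ∃ α : ℝ, ∀ μ : ℂ, 0 < μ.im → exp (α * I) * e.sPlus μ = e.sMinus μ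

/-- The relation `e^{2iφ} s₋ = s₊` on the open upper half plane. -/
def PhaseRelation (φ : ℝ) : Prop :=
  ∀ μ : ℂ, 0 < μ.im → exp (2 * φ * I) * e.sMinus μ = e.sPlus μ

/-- The subspace `M` spanned by `d₁ = e₊₊ + U₁₁ e₊₋ + U₁₂ e₋₊` and
`d₂ = e₋₋ + U₂₁ e₊₋ + U₂₂ e₋₊`. -/
def M (U : Matrix (Fin 2) (Fin 2) ℂ) : Submodule ℂ H :=
  Submodule.span ℂ {e.pp + U 0 0 • e.pm + U 0 1 • e.mp, e.mm + U 1 0 • e.pm + U 1 1 • e.mp}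

/-- The operator `A_U = S* ↾ (D(S) + M)`. -/
def extension (U : Matrix (Fin 2) (Fin 2) ℂ) : H →ₗ.[ℂ] H :=
  S.adjoint.domRestrict (S.domain ⊔ e.M U)

end DefectBasis

/-- The matrix `e^{iφ} diag(e^{iγ}, e^{-iγ})`. -/
def diagU (φ γ : ℝ) : Matrix (Fin 2) (Fin 2) ℂ :=
  exp (φ * I) • !![exp (γ * I), 0; 0, exp (-γ * I)]

end JExt

end

/-! By von Neumann's formula every element of D(S*) is, modulo D(S), a unique combination of the
four generators, with coordinates (a, b, c, d) along e₊₊, e₊₋, e₋₊, e₋₋. Since J commutes with S,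
Green's formula for [·,·] turns into a multiple of the hermitian form |a|² - |b|² - |c|² + |d|²
(`green`). A J-self-adjoint extension lies between S and S*, and its coordinates fill a subspace of
ℂ⁴ equal to its own orthogonal complement for this form of signature (2,2). Such subspaces are
exactly the graphs of unitary maps (a, d) ↦ (b, c), which gives the bijection with the matrices U.

For Im μ > 0 the subspace N_μ consists, modulo D(S), of the vectors (a, b, -a s₊(μ), -b s₋(μ))
(`exists_add_vec_mem_defect`, `eq_of_add_vec_mem_defect`). So μ is an eigenvalue of A_U exactly when
this plane meets the graph of U nontrivially. A dimension count shows that a non-eigenvalue in the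
upper half plane is a resolvent point (`mem_resolventSet_extension`). Conversely, if the whole upper
half plane consists of eigenvalues, the symmetry μ ↦ conj μ of the resolvent set excludes the lower
half plane, and a norm estimate excludes the real line (`resolventSet_eq_empty`).

Hence the resolvent set is empty iff every μ in the upper half plane is an eigenvalue. At μ = i both
s₊ and s₋ vanish, which forces U to be diagonal; the remaining condition is s₊ = U₁₁ U₂₂ s₋
(`resolventSet_extension_eq_empty_iff`). If Sh is not identically zero this fixes det U = e^{2iφ};
if Sh ≡ 0 every diagonal unitary matrix qualifies. -/

noncomputable section

namespace JExt

open Complex ComplexConjugate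

/-! ### Ranges, defect subspaces and von Neumann's formula for a symmetric operator -/

section Symmetric

variable {H : Type*} [NormedAddCommGroup H] [InnerProductSpace ℂ H]

theorem mem_graph_domRestrict (A : H →ₗ.[ℂ] H) (K : Submodule ℂ H) (x y : H) :
    (x, y) ∈ (A.domRestrict K).graph ↔ x ∈ K ∧ (x, y) ∈ A.graph := by
  simp only [LinearPMap.mem_graph_iff]
  constructor
  · rintro ⟨⟨z, hz⟩, rfl, rfl⟩
    exact ⟨hz.1, ⟨z, hz.2⟩, rfl, (LinearPMap.domRestrict_apply rfl).symm⟩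
  · rintro ⟨hK, ⟨z, hz⟩, rfl, rfl⟩
    exact ⟨⟨z, hK, hz⟩, rfl, LinearPMap.domRestrict_apply rfl⟩

theorem fst_mem_domain {A : H →ₗ.[ℂ] H} {x y : H} (h : (x, y) ∈ A.graph) : x ∈ A.domain :=
  LinearPMap.mem_domain_of_mem_graph h

theorem inner_graph_comm {S : H →ₗ.[ℂ] H} (hsymm : S.IsFormalAdjoint S) {u v a b : H}
    (h : (u, v) ∈ S.graph) (h' : (a, b) ∈ S.graph) : inner ℂ v a = inner ℂ u b := by
  obtain ⟨x, rfl, rfl⟩ := (LinearPMap.mem_graph_iff _).1 h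
  obtain ⟨y, rfl, rfl⟩ := (LinearPMap.mem_graph_iff _).1 h'
  exact hsymm x y

theorem inner_graph_self_im {S : H →ₗ.[ℂ] H} (hsymm : S.IsFormalAdjoint S) {u v : H}
    (h : (u, v) ∈ S.graph) : (inner ℂ u v).im = 0 := by
  rw [← conj_eq_iff_im, inner_conj_symm]
  exact inner_graph_comm hsymm h h

theorem norm_sq_add_I_smul {S : H →ₗ.[ℂ] H} (hsymm : S.IsFormalAdjoint S) {u v : H}
    (h : (u, v) ∈ S.graph) : ‖v + I • u‖ ^ 2 = ‖v‖ ^ 2 + ‖u‖ ^ 2 := by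
  have h1 := inner_graph_self_im hsymm h
  have h2 : (inner ℂ v u).im = 0 := by rw [inner_graph_comm hsymm h h, h1]
  rw [@norm_add_sq ℂ, inner_smul_right, norm_smul]
  simp [h2]

theorem norm_sq_sub_I_smul {S : H →ₗ.[ℂ] H} (hsymm : S.IsFormalAdjoint S) {u v : H}
    (h : (u, v) ∈ S.graph) : ‖v - I • u‖ ^ 2 = ‖v‖ ^ 2 + ‖u‖ ^ 2 := by
  have h1 := inner_graph_self_im hsymm h
  have h2 : (inner ℂ v u).im = 0 := by rw [inner_graph_comm hsymm h h, h1]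
  rw [@norm_sub_sq ℂ, inner_smul_right, norm_smul]
  simp [h2]

theorem abs_im_mul_norm_le {S : H →ₗ.[ℂ] H} (hsymm : S.IsFormalAdjoint S) {u v : H}
    (h : (u, v) ∈ S.graph) (z : ℂ) : |z.im| * ‖u‖ ≤ ‖v - z • u‖ := by
  have h1 := inner_graph_self_im hsymm h
  have h2 : (inner ℂ u (v - z • u)).im = -(z.im * ‖u‖ ^ 2) := by
    rw [inner_sub_right, inner_smul_right, inner_self_eq_norm_sq_to_K, sub_im, h1]
    simp [← ofReal_pow]
  have h3 : |z.im| * ‖u‖ ^ 2 ≤ ‖u‖ * ‖v - z • u‖ := by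
    calc |z.im| * ‖u‖ ^ 2 = |(inner ℂ u (v - z • u)).im| := by
          rw [h2, abs_neg, abs_mul, abs_of_nonneg (sq_nonneg ‖u‖)]
      _ ≤ ‖inner ℂ u (v - z • u)‖ := abs_im_le_norm _
      _ ≤ _ := norm_inner_le_norm _ _
  rcases (norm_nonneg u).eq_or_lt with h0 | h0
  · rw [← h0]; simp
  · nlinarith

/-- The range of `A - z`. -/
def rangeSub (A : H →ₗ.[ℂ] H) (z : ℂ) : Submodule ℂ H :=
  A.graph.map (LinearMap.snd ℂ H H - z • LinearMap.fst ℂ H H)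

theorem mem_rangeSub {A : H →ₗ.[ℂ] H} {z : ℂ} {y : H} :
    y ∈ rangeSub A z ↔ ∃ u v, (u, v) ∈ A.graph ∧ v - z • u = y := by
  simp [rangeSub, -LinearPMap.mem_graph_iff]

/-- Serves to show that no nonzero vector of ran(S - conj μ) lies in N_i, the orthogonal complement
of ran(S + i). -/
theorem graph_eq_zero_of_inner_eq_zero {S : H →ₗ.[ℂ] H} (hsymm : S.IsFormalAdjoint S) {μ : ℂ}
    (hμ : 0 < μ.im) {u v : H} (h : (u, v) ∈ S.graph)
    (h0 : inner ℂ (v + I • u) (v - conj μ • u) = 0) : u = 0 ∧ v = 0 := by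
  have him := inner_graph_self_im hsymm h
  have hvu := inner_graph_comm hsymm h h
  set q := (inner ℂ u v).re with hq
  have huv : inner ℂ u v = (q : ℂ) := by apply Complex.ext <;> simp [him, hq]
  have hcs : q ^ 2 ≤ ‖u‖ ^ 2 * ‖v‖ ^ 2 := by
    rw [← mul_pow, ← sq_abs]
    gcongr
    exact (abs_re_le_norm _).trans (norm_inner_le_norm u v)
  have h1 : ((‖v‖ ^ 2 : ℝ) : ℂ) - conj μ * q - I * q + I * conj μ * ((‖u‖ ^ 2 : ℝ) : ℂ) = 0 := by
    rw [← h0, inner_add_left, inner_sub_right, inner_sub_right, inner_smul_left, inner_smul_left,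
      inner_smul_right, inner_smul_right, hvu, huv, inner_self_eq_norm_sq_to_K,
      inner_self_eq_norm_sq_to_K, conj_I]
    simp only [coe_algebraMap]
    push_cast
    ring
  have hre := congrArg re h1
  have him' := congrArg im h1
  simp only [add_re, sub_re, mul_re, add_im, sub_im, mul_im, ofReal_re, ofReal_im, conj_re,
    conj_im, I_re, I_im, zero_re, zero_im] at hre him'
  ring_nf at hre him'
  set s := μ.re
  set t := μ.im
  have hA : 0 ≤ ‖u‖ ^ 2 := sq_nonneg _
  have hB : 0 ≤ ‖v‖ ^ 2 := sq_nonneg _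
  have hu : ‖u‖ ^ 2 = 0 := by
    by_contra hne
    have hpos : 0 < ‖u‖ ^ 2 := lt_of_le_of_ne hA (Ne.symm hne)
    -- With q = (u, v), real and imaginary parts combine to (‖v‖² + t‖u‖²)‖u‖² = q²(1 - t). For t ≥
    -- 1 the signs disagree; for t < 1 the Cauchy–Schwarz bound on q² gives the contradiction.
    have h3 : s * q * ‖u‖ ^ 2 = q ^ 2 * (1 - t) := by linear_combination q * him'
    have h4 : s * q = ‖v‖ ^ 2 + t * ‖u‖ ^ 2 := by linear_combination -hre
    rw [h4] at h3
    have h5 : 0 < (‖v‖ ^ 2 + t * ‖u‖ ^ 2) * ‖u‖ ^ 2 := by positivity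
    rcases le_or_gt 1 t with h6 | h6
    · nlinarith [sq_nonneg q]
    · have h7 : q ^ 2 * (1 - t) ≤ ‖u‖ ^ 2 * ‖v‖ ^ 2 * (1 - t) := by
        gcongr
      have h8 : 0 < t * ‖u‖ ^ 2 * ‖u‖ ^ 2 := by positivity
      have h9 : 0 ≤ ‖u‖ ^ 2 * ‖v‖ ^ 2 * t := by positivity
      nlinarith
  have hu0 : u = 0 := by simpa using hu
  exact ⟨hu0, S.graph_fst_eq_zero_snd h hu0⟩

variable [CompleteSpace H]

/-- On the complete space `S.graph` the map (u, v) ↦ v - z u is bounded below, because |Im z| ‖u‖ ≤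
‖v - z u‖ also controls ‖v‖. -/
theorem isClosed_rangeSub {S : H →ₗ.[ℂ] H} (hclosed : S.IsClosed) (hsymm : S.IsFormalAdjoint S)
    {z : ℂ} (hz : z.im ≠ 0) : IsClosed (rangeSub S z : Set H) := by
  have hc : CompleteSpace S.graph := IsClosed.completeSpace_coe (hs := hclosed)
  let φ : S.graph →L[ℂ] H :=
    (ContinuousLinearMap.snd ℂ H H - z • ContinuousLinearMap.fst ℂ H H).comp S.graph.subtypeL
  have hφ : ∀ p : S.graph, φ p = (p : H × H).2 - z • (p : H × H).1 := fun p => rfl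
  have hz' : 0 < |z.im| := abs_pos.2 hz
  have key : ∀ p : S.graph, ‖p‖ ≤ (1 + (1 + ‖z‖) / |z.im|) * ‖φ p‖ := by
    rintro ⟨⟨u, v⟩, h⟩
    have h1 : ‖u‖ ≤ ‖v - z • u‖ / |z.im| := by
      rw [le_div_iff₀ hz', mul_comm]; exact abs_im_mul_norm_le hsymm h z
    have h2 : ‖v‖ ≤ ‖v - z • u‖ + ‖z‖ * ‖u‖ := by
      rw [← norm_smul]
      simpa using norm_add_le (v - z • u) (z • u)
    have h3 : ‖z‖ * ‖u‖ ≤ ‖z‖ * (‖v - z • u‖ / |z.im|) := by gcongr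
    have h4 : 0 ≤ ‖v - z • u‖ / |z.im| := by positivity
    have h5 : 0 ≤ ‖z‖ * (‖v - z • u‖ / |z.im|) := by positivity
    have e : (1 + (1 + ‖z‖) / |z.im|) * ‖v - z • u‖
        = ‖v - z • u‖ + ‖v - z • u‖ / |z.im| + ‖z‖ * (‖v - z • u‖ / |z.im|) := by ring
    change max ‖u‖ ‖v‖ ≤ _ * ‖v - z • u‖
    rw [e]
    refine max_le ?_ ?_
    · linarith [norm_nonneg (v - z • u)]
    · linarith
  have hanti : AntilipschitzWith ⟨1 + (1 + ‖z‖) / |z.im|, by positivity⟩ φ :=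
    AddMonoidHomClass.antilipschitz_of_bound φ key
  have := hanti.isClosed_range φ.uniformContinuous
  convert this using 1
  ext y
  simp only [SetLike.mem_coe, mem_rangeSub, Set.mem_range]
  constructor
  · rintro ⟨u, v, h, rfl⟩
    exact ⟨⟨(u, v), h⟩, rfl⟩
  · rintro ⟨⟨⟨u, v⟩, h⟩, rfl⟩
    exact ⟨u, v, h, rfl⟩

theorem mem_adjoint_graph {S : H →ₗ.[ℂ] H} (hdense : Dense (S.domain : Set H)) {x y : H} :
    (x, y) ∈ S.adjoint.graph ↔ ∀ u v, (u, v) ∈ S.graph → inner ℂ v x = inner ℂ u y := by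
  rw [LinearPMap.adjoint_graph_eq_graph_adjoint hdense, Submodule.mem_adjoint_iff]
  simp only [sub_eq_zero]

theorem mem_adjoint_graph_of_mem {S : H →ₗ.[ℂ] H} (hdense : Dense (S.domain : Set H))
    (hsymm : S.IsFormalAdjoint S) {u v : H} (h : (u, v) ∈ S.graph) : (u, v) ∈ S.adjoint.graph :=
  (mem_adjoint_graph hdense).2 fun _ _ h' => inner_graph_comm hsymm h' h

theorem mem_defect {S : H →ₗ.[ℂ] H} {z : ℂ} {x : H} :
    x ∈ defect S z ↔ (x, z • x) ∈ S.adjoint.graph := Iff.rfl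

theorem inner_sub_smul_defect {S : H →ₗ.[ℂ] H} (hdense : Dense (S.domain : Set H)) {z : ℂ}
    {u v n : H} (h : (u, v) ∈ S.graph) (hn : n ∈ defect S (conj z)) :
    inner ℂ (v - z • u) n = 0 := by
  rw [inner_sub_left, inner_smul_left, (mem_adjoint_graph hdense).1 (mem_defect.1 hn) u v h,
    inner_smul_right, sub_self]

theorem orthogonal_rangeSub {S : H →ₗ.[ℂ] H} (hdense : Dense (S.domain : Set H)) (z : ℂ) :
    (rangeSub S z)ᗮ = defect S (conj z) := by
  ext n
  constructor
  · intro hn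
    rw [mem_defect, mem_adjoint_graph hdense]
    intro u v h
    have := (Submodule.mem_orthogonal _ _).1 hn _ (mem_rangeSub.2 ⟨u, v, h, rfl⟩)
    rwa [inner_sub_left, inner_smul_left, sub_eq_zero, ← inner_smul_right] at this
  · intro hn
    rw [Submodule.mem_orthogonal]
    intro y hy
    obtain ⟨u, v, h, rfl⟩ := mem_rangeSub.1 hy
    exact inner_sub_smul_defect hdense h hn

theorem exists_sub_smul_add_defect {S : H →ₗ.[ℂ] H} (hdense : Dense (S.domain : Set H))
    (hclosed : S.IsClosed) (hsymm : S.IsFormalAdjoint S) {z : ℂ} (hz : z.im ≠ 0) (y : H) :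
    ∃ u v n, (u, v) ∈ S.graph ∧ n ∈ defect S (conj z) ∧ y = v - z • u + n := by
  have hc : CompleteSpace (rangeSub S z) :=
    (isClosed_rangeSub hclosed hsymm hz).completeSpace_coe
  obtain ⟨r, hr, n, hn, rfl⟩ := (rangeSub S z).exists_add_mem_mem_orthogonal y
  obtain ⟨u, v, h, rfl⟩ := mem_rangeSub.1 hr
  rw [orthogonal_rangeSub hdense] at hn
  exact ⟨u, v, n, h, hn, rfl⟩

theorem inner_add_I_smul_defect {S : H →ₗ.[ℂ] H} (hdense : Dense (S.domain : Set H))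
    {u v n : H} (h : (u, v) ∈ S.graph) (hn : n ∈ defect S I) : inner ℂ (v + I • u) n = 0 := by
  have := inner_sub_smul_defect (z := -I) hdense h (n := n) (by simpa using hn)
  simpa using this

theorem inner_sub_I_smul_defect {S : H →ₗ.[ℂ] H} (hdense : Dense (S.domain : Set H))
    {u v n : H} (h : (u, v) ∈ S.graph) (hn : n ∈ defect S (-I)) : inner ℂ (v - I • u) n = 0 :=
  inner_sub_smul_defect hdense h (by simpa using hn)

/-- Von Neumann's formula `D(S*) = D(S) + N_i + N_{-i}`. -/
theorem exists_von_neumann {S : H →ₗ.[ℂ] H} (hdense : Dense (S.domain : Set H))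
    (hclosed : S.IsClosed) (hsymm : S.IsFormalAdjoint S) {f g : H}
    (hfg : (f, g) ∈ S.adjoint.graph) :
    ∃ u v a b, (u, v) ∈ S.graph ∧ a ∈ defect S I ∧ b ∈ defect S (-I) ∧ f = u + a + b ∧
      g = v + I • a - I • b := by
  obtain ⟨u, v, n, h, hn, e⟩ :=
    exists_sub_smul_add_defect hdense hclosed hsymm (z := -I) (by simp) (g + I • f)
  rw [map_neg, conj_I, neg_neg] at hn
  have hI : (2 * I) ≠ (0 : ℂ) := by simp
  -- S* + i acts on N_i as multiplication by 2i and kills N_{-i}, so n is 2i times the N_i-component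
  -- of f.
  set a := (2 * I)⁻¹ • n with ha
  have han : n = (2 * I) • a := by rw [ha, smul_inv_smul₀ hI]
  have ha' : a ∈ defect S I := Submodule.smul_mem _ _ hn
  have hg : g = v + I • u + (2 * I) • a - I • f := by
    rw [← han, eq_sub_iff_add_eq, e]; module
  refine ⟨u, v, a, f - u - a, h, ha', ?_, by abel, ?_⟩
  · rw [mem_defect]
    have := sub_mem (sub_mem hfg (mem_adjoint_graph_of_mem hdense hsymm h)) (mem_defect.1 ha')
    convert this using 1
    rw [Prod.mk_sub_mk, Prod.mk_sub_mk, hg]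
    congr 1
    module
  · rw [hg]; module

/-- Applying S* + i or S* - i kills one defect component and puts the other into ran(S + i) or ran(S
- i), to which it is orthogonal. -/
theorem von_neumann_unique {S : H →ₗ.[ℂ] H} (hdense : Dense (S.domain : Set H))
    (hsymm : S.IsFormalAdjoint S) {u a b : H} (hu : u ∈ S.domain) (ha : a ∈ defect S I)
    (hb : b ∈ defect S (-I)) (h0 : u + a + b = 0) : a = 0 ∧ b = 0 := by
  obtain ⟨v, h⟩ := LinearPMap.mem_domain_iff.1 hu
  have h1 := add_mem (add_mem (mem_adjoint_graph_of_mem hdense hsymm h) (mem_defect.1 ha))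
    (mem_defect.1 hb)
  rw [Prod.mk_add_mk, Prod.mk_add_mk, h0] at h1
  have h2 : v + I • a + -I • b = 0 := S.adjoint.graph_fst_eq_zero_snd h1 rfl
  constructor
  · have h3 : v + I • u = -(2 * I) • a := by
      linear_combination (norm := module) h2 + I • h0
    have h4 := inner_add_I_smul_defect hdense h ha
    rw [h3, inner_smul_left] at h4
    simpa using h4
  · have h3 : v - I • u = (2 * I) • b := by
      linear_combination (norm := module) h2 - I • h0
    have h4 := inner_sub_I_smul_defect hdense h hb
    rw [h3, inner_smul_left] at h4
    simpa using h4

theorem normSq_sub_I_lt {μ : ℂ} (hμ : 0 < μ.im) : ‖μ - I‖ ^ 2 < ‖μ + I‖ ^ 2 := by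
  rw [← normSq_eq_norm_sq, ← normSq_eq_norm_sq, normSq_apply, normSq_apply]
  simp
  nlinarith

/-- For `μ` in the upper half plane, `N_μ` meets `D(S) + N_{-i}` trivially. -/
theorem defect_eq_zero_of_upper {S : H →ₗ.[ℂ] H} (hdense : Dense (S.domain : Set H))
    (hsymm : S.IsFormalAdjoint S) {μ : ℂ} (hμ : 0 < μ.im) {u b : H} (hu : u ∈ S.domain)
    (hb : b ∈ defect S (-I)) (hf : u + b ∈ defect S μ) : u + b = 0 := by
  obtain ⟨v, h⟩ := LinearPMap.mem_domain_iff.1 hu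
  have h1 := add_mem (mem_adjoint_graph_of_mem hdense hsymm h) (mem_defect.1 hb)
  have h2 : v + -I • b = μ • (u + b) := S.adjoint.mem_graph_snd_inj h1 hf rfl
  -- (μ + i)f equals (S + i)u, while (μ - i)f is (S - i)u plus an orthogonal vector. As (S ± i)u
  -- have equal norms, f ≠ 0 would give |μ - i| ≥ |μ + i|.
  have h3 : (μ + I) • (u + b) = v + I • u := by rw [add_smul, ← h2]; module
  have h4 : (μ - I) • (u + b) = (v - I • u) + (-(2 * I)) • b := by rw [sub_smul, ← h2]; module
  have h5 : ‖μ - I‖ ^ 2 * ‖u + b‖ ^ 2 = ‖v - I • u‖ ^ 2 + ‖(-(2 * I)) • b‖ ^ 2 := by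
    rw [← mul_pow, ← norm_smul, h4, @norm_add_sq ℂ, inner_smul_right,
      inner_sub_I_smul_defect hdense h hb]
    simp
  have h6 : ‖μ + I‖ ^ 2 * ‖u + b‖ ^ 2 = ‖v‖ ^ 2 + ‖u‖ ^ 2 := by
    rw [← mul_pow, ← norm_smul, h3, norm_sq_add_I_smul hsymm h]
  rw [norm_sq_sub_I_smul hsymm h, ← h6] at h5
  by_contra hne
  have h7 : 0 < ‖u + b‖ ^ 2 := by positivity
  nlinarith [normSq_sub_I_lt hμ, sq_nonneg ‖(-(2 * I)) • b‖]

/-- For `μ` in the lower half plane, `N_μ` meets `D(S) + N_i` trivially. -/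
theorem defect_eq_zero_of_lower {S : H →ₗ.[ℂ] H} (hdense : Dense (S.domain : Set H))
    (hsymm : S.IsFormalAdjoint S) {μ : ℂ} (hμ : μ.im < 0) {u a : H} (hu : u ∈ S.domain)
    (ha : a ∈ defect S I) (hf : u + a ∈ defect S μ) : u + a = 0 := by
  obtain ⟨v, h⟩ := LinearPMap.mem_domain_iff.1 hu
  have h1 := add_mem (mem_adjoint_graph_of_mem hdense hsymm h) (mem_defect.1 ha)
  have h2 : v + I • a = μ • (u + a) := S.adjoint.mem_graph_snd_inj h1 hf rfl
  have h3 : (μ - I) • (u + a) = v - I • u := by rw [sub_smul, ← h2]; module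
  have h4 : (μ + I) • (u + a) = (v + I • u) + (2 * I) • a := by rw [add_smul, ← h2]; module
  have h5 : ‖μ + I‖ ^ 2 * ‖u + a‖ ^ 2 = ‖v + I • u‖ ^ 2 + ‖(2 * I) • a‖ ^ 2 := by
    rw [← mul_pow, ← norm_smul, h4, @norm_add_sq ℂ, inner_smul_right,
      inner_add_I_smul_defect hdense h ha]
    simp
  have h6 : ‖μ - I‖ ^ 2 * ‖u + a‖ ^ 2 = ‖v‖ ^ 2 + ‖u‖ ^ 2 := by
    rw [← mul_pow, ← norm_smul, h3, norm_sq_sub_I_smul hsymm h]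
  rw [norm_sq_add_I_smul hsymm h, ← h6] at h5
  have h8 : ‖μ + I‖ ^ 2 < ‖μ - I‖ ^ 2 := by
    rw [← normSq_eq_norm_sq, ← normSq_eq_norm_sq, normSq_apply, normSq_apply]
    simp
    nlinarith
  by_contra hne
  have h7 : 0 < ‖u + a‖ ^ 2 := by positivity
  nlinarith [sq_nonneg ‖(2 * I) • a‖]

/-- The orthogonal projection of N_μ to N_{-i} is injective: a vector in its kernel has no
N_{-i}-component in von Neumann's formula, hence lies in D(S) + N_i and vanishes. -/
theorem finrank_defect_le_of_lower {S : H →ₗ.[ℂ] H} (hdense : Dense (S.domain : Set H))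
    (hclosed : S.IsClosed) (hsymm : S.IsFormalAdjoint S) [FiniteDimensional ℂ (defect S (-I))]
    {μ : ℂ} (hμ : μ.im < 0) : FiniteDimensional ℂ (defect S μ) ∧
      Module.finrank ℂ (defect S μ) ≤ Module.finrank ℂ (defect S (-I)) := by
  let P : defect S μ →ₗ[ℂ] defect S (-I) :=
    (defect S (-I)).orthogonalProjectionOnto.toLinearMap ∘ₗ (defect S μ).subtype
  have hP : Function.Injective P := by
    rw [injective_iff_map_eq_zero]
    rintro ⟨f, hf⟩ h0
    have h0' : f ∈ (defect S (-I))ᗮ := Submodule.orthogonalProjectionOnto_eq_zero_iff.1 h0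
    obtain ⟨u, v, a, b, h, ha, hb, e, e'⟩ :=
      exists_von_neumann hdense hclosed hsymm (mem_defect.1 hf)
    have h1 : (μ - I) • f = v - I • u - (2 * I) • b := by
      rw [sub_smul, e', e]; module
    have h2 : inner ℂ ((μ - I) • f) b = 0 := by
      rw [inner_smul_left, (Submodule.mem_orthogonal' _ _).1 h0' b hb, mul_zero]
    rw [h1, inner_sub_left, inner_sub_I_smul_defect hdense h hb, inner_smul_left] at h2
    have hb0 : b = 0 := by simpa using h2
    rw [hb0, add_zero] at e
    subst e
    exact Subtype.ext (defect_eq_zero_of_lower hdense hsymm hμ (fst_mem_domain h) ha hf)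
  exact ⟨Module.Finite.of_injective P hP, LinearMap.finrank_le_finrank_of_injective hP⟩

/-- For `μ` in the upper half plane, every `a ∈ N_i` is the `N_i`-component of an element
of `N_μ`. -/
theorem exists_add_sub_mem_defect {S : H →ₗ.[ℂ] H} (hdense : Dense (S.domain : Set H))
    (hclosed : S.IsClosed) (hsymm : S.IsFormalAdjoint S) [FiniteDimensional ℂ (defect S I)]
    {μ : ℂ} (hμ : 0 < μ.im) {a : H} (ha : a ∈ defect S I) :
    ∃ u ∈ S.domain, ∃ b ∈ defect S (-I), u + a - b ∈ defect S μ := by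
  -- T collects the N_i-components of elements of N_μ. It has finite dimension, so it suffices that
  -- the part t' of a orthogonal to T is zero.
  set T : Submodule ℂ H := defect S I ⊓ (defect S μ ⊔ (S.domain ⊔ defect S (-I))) with hT
  have hTfin : FiniteDimensional ℂ T := Submodule.finiteDimensional_of_le inf_le_left
  suffices h : a ∈ T by
    obtain ⟨f, hf, w, hw, e⟩ := Submodule.mem_sup.1 h.2
    obtain ⟨u, hu, b, hb, rfl⟩ := Submodule.mem_sup.1 hw
    refine ⟨-u, neg_mem hu, b, hb, ?_⟩
    convert hf using 1
    rw [← e]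
    abel
  obtain ⟨t, ht, t', ht', rfl⟩ := T.exists_add_mem_mem_orthogonal a
  have ht'I : t' ∈ defect S I := by simpa using sub_mem ha ht.1
  have hμI : μ + I ≠ 0 := by
    intro h
    have := congrArg im h
    simp at this
    linarith
  have horth : ∀ f ∈ defect S μ, inner ℂ f t' = 0 := by
    intro f hf
    obtain ⟨u, v, c, b, h, hc, hb, e, e'⟩ :=
      exists_von_neumann hdense hclosed hsymm (mem_defect.1 hf)
    have hcT : c ∈ T := by
      refine ⟨hc, ?_⟩
      have : c = f + (-u + -b) := by rw [e]; abel
      rw [this]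
      exact Submodule.add_mem_sup hf
        (Submodule.add_mem_sup (neg_mem (fst_mem_domain h)) (neg_mem hb))
    have h1 : (μ + I) • f = v + I • u + (2 * I) • c := by
      rw [add_smul, e', e]; module
    have h2 : inner ℂ ((μ + I) • f) t' = 0 := by
      rw [h1, inner_add_left, inner_smul_left, inner_add_I_smul_defect hdense h ht'I,
        (Submodule.mem_orthogonal _ _).1 ht' c hcT, mul_zero, add_zero]
    rw [inner_smul_left] at h2
    exact (mul_eq_zero.1 h2).resolve_left ((map_ne_zero _).2 hμI)
  -- Orthogonality to N_μ puts t' into ran(S - conj μ), while t' ∈ N_i makes it orthogonal to ran(S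
  -- + i).
  obtain ⟨u, v, n, h, hn, e⟩ := exists_sub_smul_add_defect hdense hclosed hsymm (z := conj μ)
    (by simpa using hμ.ne') t'
  rw [conj_conj] at hn
  have hn0 : n = 0 := by
    have h1 := horth n hn
    rw [e, inner_add_right, ← inner_conj_symm,
      inner_sub_smul_defect hdense h (by rwa [conj_conj]), map_zero, zero_add] at h1
    exact inner_self_eq_zero.1 h1
  rw [hn0, add_zero] at e
  have h2 := inner_add_I_smul_defect hdense h ht'I
  rw [e] at h2
  obtain ⟨rfl, rfl⟩ := graph_eq_zero_of_inner_eq_zero hsymm hμ h h2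
  have : t' = 0 := by rw [e]; simp
  simpa [this] using ht

end Symmetric

/-! ### Splitting along J, coordinates in the defect subspaces, Green's formula -/

section JSymmetric

variable {H : Type*} [NormedAddCommGroup H] [InnerProductSpace ℂ H] {J : H →L[ℂ] H}

theorem map_map_self (hJ : J * J = 1) (x : H) : J (J x) = x := by
  simpa using congrArg (fun T : H →L[ℂ] H => T x) hJ

theorem mem_posSubspace {x : H} : x ∈ posSubspace J ↔ J x = x := by
  simp [posSubspace, sub_eq_zero]

theorem mem_negSubspace {x : H} : x ∈ negSubspace J ↔ J x = -x := by
  simp [negSubspace, eq_neg_iff_add_eq_zero]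

theorem eq_zero_of_smul_add_smul {x y : H} (hx0 : x ≠ 0) (hy0 : y ≠ 0)
    (hx : J x = x) (hy : J y = -y) {a b : ℂ} (h0 : a • x + b • y = 0) : a = 0 ∧ b = 0 := by
  have h1 : a • x - b • y = 0 := by
    have := congrArg J h0
    rw [map_add, map_smul, map_smul, hx, hy, map_zero] at this
    rw [← this]; module
  constructor
  · have h2 : (2 * a) • x = 0 := by linear_combination (norm := module) h0 + h1
    simpa [hx0] using h2
  · have h2 : (2 * b) • y = 0 := by linear_combination (norm := module) h0 - h1
    simpa [hy0] using h2

variable [CompleteSpace H]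

/-- A closed densely defined symmetric operator commuting with a fundamental symmetry. -/
structure IsJSymmetric (J : H →L[ℂ] H) (S : H →ₗ.[ℂ] H) : Prop where
  selfAdjoint : IsSelfAdjoint J
  sq : J * J = 1
  dense : Dense (S.domain : Set H)
  closed : S.IsClosed
  symm : S.IsFormalAdjoint S
  comm : CommutesWith S J

variable {S : H →ₗ.[ℂ] H}

theorem inner_map_left (hJ : IsSelfAdjoint J) (x y : H) : inner ℂ (J x) y = inner ℂ x (J y) := by
  conv_lhs => rw [← hJ.adjoint_eq, ContinuousLinearMap.adjoint_inner_left]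

namespace IsJSymmetric

theorem graph_map (h : IsJSymmetric J S) {u v : H} (huv : (u, v) ∈ S.graph) :
    (J u, J v) ∈ S.graph := by
  obtain ⟨x, rfl, rfl⟩ := (LinearPMap.mem_graph_iff _).1 huv
  have hx : J x ∈ S.domain := (h.comm.1 x).2 x.2
  exact (LinearPMap.mem_graph_iff _).2 ⟨⟨J x, hx⟩, rfl, h.comm.2 x hx⟩

theorem adjoint_graph_map (h : IsJSymmetric J S) {x y : H} (hxy : (x, y) ∈ S.adjoint.graph) :
    (J x, J y) ∈ S.adjoint.graph := by
  rw [mem_adjoint_graph h.dense] at hxy ⊢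
  intro u v huv
  rw [← inner_map_left h.selfAdjoint, ← inner_map_left h.selfAdjoint]
  exact hxy _ _ (h.graph_map huv)

theorem map_mem_defect (h : IsJSymmetric J S) {z : ℂ} {x : H} (hx : x ∈ defect S z) :
    J x ∈ defect S z := by
  rw [mem_defect, ← map_smul]
  exact h.adjoint_graph_map (mem_defect.1 hx)

end IsJSymmetric

/-- The part of `S` in the range `K` of a self-adjoint projector `P` that `S` commutes with
has as its adjoint the part of `S*` in `K`. -/
theorem mem_defect_part (hdense : Dense (S.domain : Set H)) {K : Submodule ℂ H} [CompleteSpace K]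
    {P : H →L[ℂ] H} (hP : IsSelfAdjoint P) (hPK : ∀ x, P x ∈ K) (hPid : ∀ x ∈ K, P x = x)
    (hPS : ∀ u v, (u, v) ∈ S.graph → (P u, P v) ∈ S.graph) (z : ℂ) (x : K) :
    x ∈ defect (part S K) z ↔ (x : H) ∈ defect S z := by
  -- P maps D(S) into the domain of the part, and a continuous surjection carries a dense set to a
  -- dense set.
  have hpart : Dense ((part S K).domain : Set K) := by
    let P' : H → K := fun y => ⟨P y, hPK y⟩
    have hc : Continuous P' := by fun_prop
    have hs : Function.Surjective P' := fun k => ⟨k, Subtype.ext (hPid k k.2)⟩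
    refine (hs.denseRange.dense_image hc hdense).mono ?_
    rintro _ ⟨u, hu, rfl⟩
    obtain ⟨v, h⟩ := LinearPMap.mem_domain_iff.1 hu
    exact fst_mem_domain (y := P' v) ((mem_graph_part S K _ _).2 (hPS u v h))
  rw [mem_defect, mem_defect, mem_adjoint_graph hpart, mem_adjoint_graph hdense]
  constructor
  · intro hx u v h
    have := hx ⟨P u, hPK u⟩ ⟨P v, hPK v⟩ ((mem_graph_part S K _ _).2 (hPS u v h))
    simp only [Submodule.coe_inner, inner_smul_right] at this
    rwa [inner_map_left hP, inner_map_left hP, hPid _ x.2, ← inner_smul_right] at this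
  · intro hx u v h
    exact hx u v ((mem_graph_part S K _ _).1 h)

namespace IsJSymmetric

theorem mem_defect_part_pos (h : IsJSymmetric J S) (z : ℂ) (x : posSubspace J) :
    x ∈ defect (part S (posSubspace J)) z ↔ (x : H) ∈ defect S z := by
  refine mem_defect_part (P := (1 / 2 : ℂ) • (1 + J)) h.dense ?_ ?_ ?_ ?_ z x
  · refine IsSelfAdjoint.smul ?_ ((IsSelfAdjoint.one _).add h.selfAdjoint)
    rw [isSelfAdjoint_iff]; simp
  · intro x
    rw [mem_posSubspace]
    simp [map_map_self h.sq, add_comm]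
  · intro x hx
    rw [mem_posSubspace] at hx
    simp [hx]
    module
  · intro u v huv
    exact S.graph.smul_mem _ (add_mem huv (h.graph_map huv))

theorem mem_defect_part_neg (h : IsJSymmetric J S) (z : ℂ) (x : negSubspace J) :
    x ∈ defect (part S (negSubspace J)) z ↔ (x : H) ∈ defect S z := by
  refine mem_defect_part (P := (1 / 2 : ℂ) • (1 - J)) h.dense ?_ ?_ ?_ ?_ z x
  · refine IsSelfAdjoint.smul ?_ ((IsSelfAdjoint.one _).sub h.selfAdjoint)
    rw [isSelfAdjoint_iff]; simp
  · intro x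
    rw [mem_negSubspace]
    simp [map_map_self h.sq]
    module
  · intro x hx
    rw [mem_negSubspace] at hx
    simp [hx]
    module
  · intro u v huv
    exact S.graph.smul_mem _ (sub_mem huv (h.graph_map huv))

theorem mem_map_defect_pos (h : IsJSymmetric J S) {z : ℂ} {x : H} :
    x ∈ (defect (part S (posSubspace J)) z).map (posSubspace J).subtype ↔
      J x = x ∧ x ∈ defect S z := by
  simp only [Submodule.mem_map, h.mem_defect_part_pos, Submodule.subtype_apply, Subtype.exists,
    exists_and_left, exists_prop, mem_posSubspace]
  constructor
  · rintro ⟨y, hy, hJ, rfl⟩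
    exact ⟨hJ, hy⟩
  · rintro ⟨hJ, hx⟩
    exact ⟨x, hx, hJ, rfl⟩

theorem mem_map_defect_neg (h : IsJSymmetric J S) {z : ℂ} {x : H} :
    x ∈ (defect (part S (negSubspace J)) z).map (negSubspace J).subtype ↔
      J x = -x ∧ x ∈ defect S z := by
  simp only [Submodule.mem_map, h.mem_defect_part_neg, Submodule.subtype_apply, Subtype.exists,
    exists_and_left, exists_prop, mem_negSubspace]
  constructor
  · rintro ⟨y, hy, hJ, rfl⟩
    exact ⟨hJ, hy⟩
  · rintro ⟨hJ, hx⟩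
    exact ⟨x, hx, hJ, rfl⟩

end IsJSymmetric

namespace DefectBasis

variable (e : DefectBasis J S)

/-- Since the four generators have equal norms, this makes all of them nonzero. -/
theorem pp_ne_zero (hplus : HasDeficiencyIndices (part S (posSubspace J)) 1 1) : e.pp ≠ 0 := by
  intro h0
  have h1 := e.span_pp
  rw [h0, Submodule.span_zero_singleton, ← Submodule.map_bot (posSubspace J).subtype] at h1
  replace h1 := Submodule.map_injective_of_injective (posSubspace J).injective_subtype h1
  have h2 := hplus.1
  rw [h1] at h2
  simp at h2

theorem mem_pp (h : IsJSymmetric J S) : J e.pp = e.pp ∧ e.pp ∈ defect S I := by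
  rw [← h.mem_map_defect_pos, e.span_pp]; exact Submodule.mem_span_singleton_self _

theorem mem_mp (h : IsJSymmetric J S) : J e.mp = e.mp ∧ e.mp ∈ defect S (-I) := by
  rw [← h.mem_map_defect_pos, e.span_mp]; exact Submodule.mem_span_singleton_self _

theorem mem_pm (h : IsJSymmetric J S) : J e.pm = -e.pm ∧ e.pm ∈ defect S I := by
  rw [← h.mem_map_defect_neg, e.span_pm]; exact Submodule.mem_span_singleton_self _

theorem mem_mm (h : IsJSymmetric J S) : J e.mm = -e.mm ∧ e.mm ∈ defect S (-I) := by
  rw [← h.mem_map_defect_neg, e.span_mm]; exact Submodule.mem_span_singleton_self _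

theorem exists_smul_mp (h : IsJSymmetric J S) {b : H} (hb : b ∈ defect S (-I)) (hJb : J b = b) :
    ∃ c : ℂ, c • e.mp = b := by
  rw [← Submodule.mem_span_singleton, ← e.span_mp, h.mem_map_defect_pos]
  exact ⟨hJb, hb⟩

theorem exists_smul_mm (h : IsJSymmetric J S) {b : H} (hb : b ∈ defect S (-I)) (hJb : J b = -b) :
    ∃ c : ℂ, c • e.mm = b := by
  rw [← Submodule.mem_span_singleton, ← e.span_mm, h.mem_map_defect_neg]
  exact ⟨hJb, hb⟩

theorem _root_.JExt.IsJSymmetric.map_half_add (h : IsJSymmetric J S) (x : H) :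
    J ((1 / 2 : ℂ) • (x + J x)) = (1 / 2 : ℂ) • (x + J x) := by
  rw [map_smul, map_add, map_map_self h.sq, add_comm]

theorem _root_.JExt.IsJSymmetric.map_half_sub (h : IsJSymmetric J S) (x : H) :
    J ((1 / 2 : ℂ) • (x - J x)) = -((1 / 2 : ℂ) • (x - J x)) := by
  rw [map_smul, map_sub, map_map_self h.sq]; module

theorem exists_defect_I (h : IsJSymmetric J S) {x : H} (hx : x ∈ defect S I) :
    ∃ a b : ℂ, x = a • e.pp + b • e.pm := by
  have h1 : (1 / 2 : ℂ) • (x + J x) ∈ ℂ ∙ e.pp := by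
    rw [← e.span_pp, h.mem_map_defect_pos]
    exact ⟨h.map_half_add x, Submodule.smul_mem _ _ (add_mem hx (h.map_mem_defect hx))⟩
  have h2 : (1 / 2 : ℂ) • (x - J x) ∈ ℂ ∙ e.pm := by
    rw [← e.span_pm, h.mem_map_defect_neg]
    exact ⟨h.map_half_sub x, Submodule.smul_mem _ _ (sub_mem hx (h.map_mem_defect hx))⟩
  obtain ⟨a, ha⟩ := Submodule.mem_span_singleton.1 h1
  obtain ⟨b, hb⟩ := Submodule.mem_span_singleton.1 h2
  exact ⟨a, b, by rw [ha, hb]; module⟩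

theorem exists_defect_neg_I (h : IsJSymmetric J S) {x : H} (hx : x ∈ defect S (-I)) :
    ∃ c d : ℂ, x = c • e.mp + d • e.mm := by
  obtain ⟨a, ha⟩ := e.exists_smul_mp h
    (Submodule.smul_mem _ _ (add_mem hx (h.map_mem_defect hx))) (h.map_half_add x)
  obtain ⟨b, hb⟩ := e.exists_smul_mm h
    (Submodule.smul_mem _ _ (sub_mem hx (h.map_mem_defect hx))) (h.map_half_sub x)
  exact ⟨a, b, by rw [ha, hb]; module⟩

/-- The element of `N_i + N_{-i}` with coordinates `a, b, c, d`. -/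
def vec (a b c d : ℂ) : H := a • e.pp + b • e.pm + c • e.mp + d • e.mm

/-- The value of `S*` at the element of `N_i + N_{-i}` with coordinates `a, b, c, d`. -/
def vec' (a b c d : ℂ) : H := I • (a • e.pp + b • e.pm) - I • (c • e.mp + d • e.mm)

theorem vec_mem_graph (h : IsJSymmetric J S) (a b c d : ℂ) :
    (e.vec a b c d, e.vec' a b c d) ∈ S.adjoint.graph := by
  have h1 : a • e.pp + b • e.pm ∈ defect S I :=
    add_mem (Submodule.smul_mem _ _ (e.mem_pp h).2) (Submodule.smul_mem _ _ (e.mem_pm h).2)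
  have h2 : c • e.mp + d • e.mm ∈ defect S (-I) :=
    add_mem (Submodule.smul_mem _ _ (e.mem_mp h).2) (Submodule.smul_mem _ _ (e.mem_mm h).2)
  have h3 := add_mem (mem_defect.1 h1) (mem_defect.1 h2)
  convert h3 using 1
  rw [Prod.mk_add_mk]
  congr 1
  · rw [vec]; abel
  · rw [vec']; module

theorem add_vec_mem_graph (h : IsJSymmetric J S) {u v : H} (huv : (u, v) ∈ S.graph)
    (a b c d : ℂ) : (u + e.vec a b c d, v + e.vec' a b c d) ∈ S.adjoint.graph :=
  add_mem (mem_adjoint_graph_of_mem h.dense h.symm huv) (e.vec_mem_graph h a b c d)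

theorem exists_add_vec (h : IsJSymmetric J S) {f g : H} (hfg : (f, g) ∈ S.adjoint.graph) :
    ∃ u v a b c d, (u, v) ∈ S.graph ∧ f = u + e.vec a b c d ∧ g = v + e.vec' a b c d := by
  obtain ⟨u, v, x, y, huv, hx, hy, rfl, rfl⟩ := exists_von_neumann h.dense h.closed h.symm hfg
  obtain ⟨a, b, rfl⟩ := e.exists_defect_I h hx
  obtain ⟨c, d, rfl⟩ := e.exists_defect_neg_I h hy
  refine ⟨u, v, a, b, c, d, huv, ?_, ?_⟩
  · rw [vec]; module
  · rw [vec']; module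

theorem add_vec_eq_zero (h : IsJSymmetric J S) (he : e.pp ≠ 0) {u : H} (hu : u ∈ S.domain)
    {a b c d : ℂ} (h0 : u + e.vec a b c d = 0) : a = 0 ∧ b = 0 ∧ c = 0 ∧ d = 0 := by
  have hn : ‖e.pp‖ ≠ 0 := norm_ne_zero_iff.2 he
  have h1 : a • e.pp + b • e.pm ∈ defect S I :=
    add_mem (Submodule.smul_mem _ _ (e.mem_pp h).2) (Submodule.smul_mem _ _ (e.mem_pm h).2)
  have h2 : c • e.mp + d • e.mm ∈ defect S (-I) :=
    add_mem (Submodule.smul_mem _ _ (e.mem_mp h).2) (Submodule.smul_mem _ _ (e.mem_mm h).2)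
  have h3 := von_neumann_unique h.dense h.symm hu h1 h2 (by rw [← h0, vec]; abel)
  have h4 := eq_zero_of_smul_add_smul he (norm_ne_zero_iff.1 (by rwa [e.norm_pm]))
    (e.mem_pp h).1 (e.mem_pm h).1 h3.1
  have h5 := eq_zero_of_smul_add_smul (norm_ne_zero_iff.1 (by rwa [e.norm_mp]))
    (norm_ne_zero_iff.1 (by rwa [e.norm_mm])) (e.mem_mp h).1 (e.mem_mm h).1 h3.2
  exact ⟨h4.1, h4.2, h5.1, h5.2⟩

theorem vec_sub (a b c d a' b' c' d' : ℂ) :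
    e.vec a b c d - e.vec a' b' c' d' = e.vec (a - a') (b - b') (c - c') (d - d') := by
  simp only [vec]; module

theorem vec_inj (h : IsJSymmetric J S) (he : e.pp ≠ 0) {u u' : H} (hu : u ∈ S.domain)
    (hu' : u' ∈ S.domain) {a b c d a' b' c' d' : ℂ}
    (h0 : u + e.vec a b c d = u' + e.vec a' b' c' d') : a = a' ∧ b = b' ∧ c = c' ∧ d = d' := by
  have h1 : (u - u') + e.vec (a - a') (b - b') (c - c') (d - d') = 0 := by
    rw [← vec_sub, ← sub_eq_zero.2 h0]; abel
  simpa only [sub_eq_zero] using e.add_vec_eq_zero h he (sub_mem hu hu') h1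

theorem inner_pos_neg (h : IsJSymmetric J S) {x y : H} (hx : J x = x) (hy : J y = -y) :
    inner ℂ x y = 0 := by
  have := inner_map_left h.selfAdjoint x y
  rw [hx, hy, inner_neg_right] at this
  exact self_eq_neg.1 this

/-- Green's formula for the indefinite inner product. -/
theorem green (h : IsJSymmetric J S) {u v u' v' : H} (huv : (u, v) ∈ S.graph)
    (huv' : (u', v') ∈ S.graph) (a b c d a' b' c' d' : ℂ) :
    inner ℂ (J (v + e.vec' a b c d)) (u' + e.vec a' b' c' d')
      - inner ℂ (J (u + e.vec a b c d)) (v' + e.vec' a' b' c' d')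
      = -2 * I * ‖e.pp‖ ^ 2 * (conj a * a' - conj b * b' - conj c * c' + conj d * d') := by
  have h1 : inner ℂ (J v) (u' + e.vec a' b' c' d') = inner ℂ (J u) (v' + e.vec' a' b' c' d') :=
    (mem_adjoint_graph h.dense).1 (e.add_vec_mem_graph h huv' _ _ _ _) _ _ (h.graph_map huv)
  have h2 : inner ℂ (J (e.vec' a b c d)) u' = inner ℂ (J (e.vec a b c d)) v' := by
    have := (mem_adjoint_graph h.dense).1 (h.adjoint_graph_map (e.vec_mem_graph h a b c d))
      _ _ huv'
    rw [← inner_conj_symm, ← this, inner_conj_symm]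
  rw [map_add, map_add, inner_add_left, inner_add_left, h1, inner_add_right (J (e.vec' _ _ _ _)),
    inner_add_right (J (e.vec _ _ _ _)), h2]
  have n1 : inner ℂ e.pp e.pp = (‖e.pp‖ : ℂ) ^ 2 := inner_self_eq_norm_sq_to_K _
  have n2 : inner ℂ e.pm e.pm = (‖e.pp‖ : ℂ) ^ 2 := by
    rw [← e.norm_pm]; exact inner_self_eq_norm_sq_to_K _
  have n3 : inner ℂ e.mp e.mp = (‖e.pp‖ : ℂ) ^ 2 := by
    rw [← e.norm_mp]; exact inner_self_eq_norm_sq_to_K _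
  have n4 : inner ℂ e.mm e.mm = (‖e.pp‖ : ℂ) ^ 2 := by
    rw [← e.norm_mm]; exact inner_self_eq_norm_sq_to_K _
  have o : ∀ {x y : H}, J x = x → J y = -y → inner ℂ x y = 0 ∧ inner ℂ y x = 0 := by
    intro x y hx hy
    have := inner_pos_neg h hx hy
    exact ⟨this, by rw [← inner_conj_symm, this, map_zero]⟩
  have jpp := (e.mem_pp h).1
  have jpm := (e.mem_pm h).1
  have jmp := (e.mem_mp h).1
  have jmm := (e.mem_mm h).1
  -- Products of `pp` with `mp` and of `pm` with `mm` need not vanish; their coefficients cancel in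
  -- the difference, because conj i = -i.
  simp only [vec, vec', map_add, map_sub, map_smul, jpp, jpm, jmp, jmm, inner_add_left,
    inner_add_right, inner_sub_left, inner_sub_right, inner_smul_left, inner_smul_right,
    inner_neg_left, n1, n2, n3, n4, (o jpp jpm).1, (o jpp jpm).2, (o jpp jmm).1, (o jpp jmm).2,
    (o jmp jpm).1, (o jmp jpm).2, (o jmp jmm).1, (o jmp jmm).2, conj_I]
  ring

end DefectBasis

end JSymmetric

theorem mem_unitaryGroup_two_iff {U : Matrix (Fin 2) (Fin 2) ℂ} :
    U ∈ Matrix.unitaryGroup (Fin 2) ℂ ↔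
      U 0 0 * conj (U 0 0) + U 0 1 * conj (U 0 1) = 1 ∧
      U 0 0 * conj (U 1 0) + U 0 1 * conj (U 1 1) = 0 ∧
      U 1 0 * conj (U 0 0) + U 1 1 * conj (U 0 1) = 0 ∧
      U 1 0 * conj (U 1 0) + U 1 1 * conj (U 1 1) = 1 := by
  rw [Matrix.mem_unitaryGroup_iff, ← Matrix.ext_iff]
  simp [Fin.forall_fin_two, Matrix.mul_apply, Fin.sum_univ_two, and_assoc]

/-- The row relations express that the graph of U is neutral for the form, the column relations that
it is maximal. -/
theorem unitaryGroup_two_columns {U : Matrix (Fin 2) (Fin 2) ℂ}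
    (hU : U ∈ Matrix.unitaryGroup (Fin 2) ℂ) :
      conj (U 0 0) * U 0 0 + conj (U 1 0) * U 1 0 = 1 ∧
      conj (U 0 0) * U 0 1 + conj (U 1 0) * U 1 1 = 0 ∧
      conj (U 0 1) * U 0 0 + conj (U 1 1) * U 1 0 = 0 ∧
      conj (U 0 1) * U 0 1 + conj (U 1 1) * U 1 1 = 1 := by
  rw [Matrix.mem_unitaryGroup_iff', ← Matrix.ext_iff] at hU
  simpa [Fin.forall_fin_two, Matrix.mul_apply, Fin.sum_univ_two, and_assoc] using hU

/-! ### J-self-adjoint extensions as graphs of unitary matrices -/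

section Extensions

variable {H : Type*} [NormedAddCommGroup H] [InnerProductSpace ℂ H]
  {J : H →L[ℂ] H} {S A : H →ₗ.[ℂ] H}

theorem IsJSelfAdjoint.mem_graph_iff (hA : IsJSelfAdjoint J A) {x y : H} :
    (x, y) ∈ A.graph ↔ ∀ u v, (u, v) ∈ A.graph → inner ℂ (J v) x = inner ℂ (J u) y := by
  rw [hA.2]
  constructor
  · rintro h u v huv
    obtain ⟨w, rfl, rfl⟩ := (LinearPMap.mem_graph_iff _).1 huv
    exact h w
  · exact fun h w => h _ _ (A.mem_graph w)

theorem isJSelfAdjoint_of_graph (hd : Dense (A.domain : Set H))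
    (hA : ∀ x y, (x, y) ∈ A.graph ↔
      ∀ u v, (u, v) ∈ A.graph → inner ℂ (J v) x = inner ℂ (J u) y) : IsJSelfAdjoint J A := by
  refine ⟨hd, fun x y => (hA x y).trans ⟨fun h w => h _ _ (A.mem_graph w), ?_⟩⟩
  rintro h u v huv
  obtain ⟨w, rfl, rfl⟩ := (LinearPMap.mem_graph_iff _).1 huv
  exact h w

variable [CompleteSpace H]

/-- J maps the graph of S onto itself, so the adjoint of S for [·,·] is S* itself. -/
theorem IsJSymmetric.mem_adjoint_graph_of_forall (h : IsJSymmetric J S) {x y : H}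
    (hxy : ∀ u v, (u, v) ∈ S.graph → inner ℂ (J v) x = inner ℂ (J u) y) :
    (x, y) ∈ S.adjoint.graph := by
  rw [mem_adjoint_graph h.dense]
  intro u v huv
  simpa only [map_map_self h.sq] using hxy _ _ (h.graph_map huv)

theorem graph_le_adjoint (h : IsJSymmetric J S) (hA : A ∈ jSelfAdjointExtensions J S) {x y : H}
    (hxy : (x, y) ∈ A.graph) : (x, y) ∈ S.adjoint.graph :=
  h.mem_adjoint_graph_of_forall fun u v huv =>
    hA.2.mem_graph_iff.1 hxy u v (LinearPMap.le_graph_of_le hA.1 huv)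

namespace DefectBasis

variable (e : DefectBasis J S)

theorem mem_graph_extension (h : IsJSymmetric J S) (U : Matrix (Fin 2) (Fin 2) ℂ) {x y : H} :
    (x, y) ∈ (e.extension U).graph ↔ ∃ u v α δ, (u, v) ∈ S.graph ∧
      x = u + e.vec α (α * U 0 0 + δ * U 1 0) (α * U 0 1 + δ * U 1 1) δ ∧
      y = v + e.vec' α (α * U 0 0 + δ * U 1 0) (α * U 0 1 + δ * U 1 1) δ := by
  rw [extension, mem_graph_domRestrict]
  constructor
  · rintro ⟨hx, hxy⟩
    obtain ⟨u, hu, m, hm, rfl⟩ := Submodule.mem_sup.1 hx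
    obtain ⟨α, δ, rfl⟩ := Submodule.mem_span_pair.1 hm
    obtain ⟨v, huv⟩ := LinearPMap.mem_domain_iff.1 hu
    have hm' : u + (α • (e.pp + U 0 0 • e.pm + U 0 1 • e.mp) +
        δ • (e.mm + U 1 0 • e.pm + U 1 1 • e.mp)) =
        u + e.vec α (α * U 0 0 + δ * U 1 0) (α * U 0 1 + δ * U 1 1) δ := by
      rw [vec]; module
    exact ⟨u, v, α, δ, huv, hm', S.adjoint.mem_graph_snd_inj hxy
      (e.add_vec_mem_graph h huv _ _ _ _) hm'⟩
  · rintro ⟨u, v, α, δ, huv, rfl, rfl⟩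
    refine ⟨Submodule.add_mem_sup (fst_mem_domain huv) ?_, e.add_vec_mem_graph h huv _ _ _ _⟩
    refine Submodule.mem_span_pair.2 ⟨α, δ, ?_⟩
    rw [vec]; module

theorem le_extension (h : IsJSymmetric J S) (U : Matrix (Fin 2) (Fin 2) ℂ) :
    S ≤ e.extension U := by
  refine LinearPMap.le_of_le_graph ?_
  rintro ⟨u, v⟩ huv
  exact (e.mem_graph_extension h U).2 ⟨u, v, 0, 0, huv, by simp [vec], by simp [vec']⟩

theorem neg_two_I_norm_ne_zero (he : e.pp ≠ 0) : -2 * I * (‖e.pp‖ : ℂ) ^ 2 ≠ 0 := by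
  simp [he]

theorem extension_mem (h : IsJSymmetric J S) (he : e.pp ≠ 0) {U : Matrix (Fin 2) (Fin 2) ℂ}
    (hU : U ∈ Matrix.unitaryGroup (Fin 2) ℂ) :
    e.extension U ∈ jSelfAdjointExtensions J S := by
  have hle := e.le_extension h U
  refine ⟨hle, isJSelfAdjoint_of_graph (h.dense.mono hle.1) fun x y => ⟨?_, fun hxy => ?_⟩⟩
  · intro hxy u v huv
    obtain ⟨u₁, v₁, α₁, δ₁, h₁, rfl, rfl⟩ := (e.mem_graph_extension h U).1 hxy
    obtain ⟨u₂, v₂, α₂, δ₂, h₂, rfl, rfl⟩ := (e.mem_graph_extension h U).1 huv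
    rw [← sub_eq_zero, e.green h h₂ h₁]
    obtain ⟨r₁, r₂, r₃, r₄⟩ := mem_unitaryGroup_two_iff.1 hU
    refine mul_eq_zero_of_right _ ?_
    simp only [map_add, map_mul]
    linear_combination (-conj α₂ * α₁) * r₁ - conj δ₂ * α₁ * r₂ - conj α₂ * δ₁ * r₃
      - conj δ₂ * δ₁ * r₄
  · have hxy' : (x, y) ∈ S.adjoint.graph := h.mem_adjoint_graph_of_forall fun u v huv =>
      hxy u v (LinearPMap.le_graph_of_le hle huv)
    obtain ⟨u, v, a, b, c, d, huv, rfl, rfl⟩ := e.exists_add_vec h hxy'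
    -- Testing against the vectors of M annihilates the form; the column relations then solve for b
    -- and c in terms of a and d.
    have key : ∀ α δ : ℂ, conj α * a - conj (α * U 0 0 + δ * U 1 0) * b
        - conj (α * U 0 1 + δ * U 1 1) * c + conj δ * d = 0 := by
      intro α δ
      have h1 := hxy _ _ ((e.mem_graph_extension h U).2
        ⟨0, 0, α, δ, zero_mem S.graph, rfl, rfl⟩)
      rw [← sub_eq_zero, e.green h (zero_mem S.graph) huv] at h1
      exact (mul_eq_zero.1 h1).resolve_left (e.neg_two_I_norm_ne_zero he)
    have k1 := key 1 0
    have k2 := key 0 1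
    simp only [map_one, map_zero, one_mul, zero_mul, add_zero, zero_add] at k1 k2
    obtain ⟨c₁, c₂, c₃, c₄⟩ := unitaryGroup_two_columns hU
    have hb : b = a * U 0 0 + d * U 1 0 := by
      linear_combination (-U 0 0) * k1 - U 1 0 * k2 - b * c₁ - c * c₃
    have hc : c = a * U 0 1 + d * U 1 1 := by
      linear_combination (-U 0 1) * k1 - U 1 1 * k2 - b * c₂ - c * c₄
    rw [e.mem_graph_extension h U]
    refine ⟨u, v, a, d, huv, ?_, ?_⟩
    · rw [← hb, ← hc]
    · rw [← hb, ← hc]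

theorem extension_injective (h : IsJSymmetric J S) (he : e.pp ≠ 0) :
    Function.Injective e.extension := by
  intro U V hUV
  have key : ∀ α δ : ℂ, α * U 0 0 + δ * U 1 0 = α * V 0 0 + δ * V 1 0 ∧
      α * U 0 1 + δ * U 1 1 = α * V 0 1 + δ * V 1 1 := by
    intro α δ
    have h1 := (e.mem_graph_extension h U).2 ⟨0, 0, α, δ, zero_mem S.graph, rfl, rfl⟩
    rw [hUV] at h1
    obtain ⟨u, v, α', δ', huv, hx, -⟩ := (e.mem_graph_extension h V).1 h1
    obtain ⟨rfl, h2, h3, rfl⟩ := e.vec_inj h he (zero_mem S.domain) (fst_mem_domain huv) hx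
    exact ⟨h2, h3⟩
  have k1 := key 1 0
  have k2 := key 0 1
  simp only [one_mul, zero_mul, add_zero, zero_add] at k1 k2
  ext i j
  fin_cases i <;> fin_cases j
  · exact k1.1
  · exact k1.2
  · exact k2.1
  · exact k2.2

theorem mem_graph_of_vec_mem (h : IsJSymmetric J S) (hA : A ∈ jSelfAdjointExtensions J S)
    {a b c d : ℂ} (hv : e.vec a b c d ∈ A.domain) :
    (e.vec a b c d, e.vec' a b c d) ∈ A.graph := by
  obtain ⟨y, hy⟩ := LinearPMap.mem_domain_iff.1 hv
  rwa [S.adjoint.mem_graph_snd_inj (graph_le_adjoint h hA hy) (e.vec_mem_graph h a b c d) rfl]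
    at hy

theorem form_eq_zero (h : IsJSymmetric J S) (he : e.pp ≠ 0)
    (hA : A ∈ jSelfAdjointExtensions J S) {a b c d a' b' c' d' : ℂ}
    (hv : e.vec a b c d ∈ A.domain) (hv' : e.vec a' b' c' d' ∈ A.domain) :
    conj a * a' - conj b * b' - conj c * c' + conj d * d' = 0 := by
  have h1 := hA.2.mem_graph_iff.1 (e.mem_graph_of_vec_mem h hA hv') _ _
    (e.mem_graph_of_vec_mem h hA hv)
  have h2 := e.green h (zero_mem S.graph) (zero_mem S.graph) a b c d a' b' c' d'
  simp only [zero_add] at h2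
  rw [h1, sub_self] at h2
  exact (mul_eq_zero.1 h2.symm).resolve_left (e.neg_two_I_norm_ne_zero he)

/-- Together with `form_eq_zero`: the coordinate space of D(A) is its own orthogonal complement for
the form. -/
theorem vec_mem_of_form (h : IsJSymmetric J S) (hA : A ∈ jSelfAdjointExtensions J S)
    {a' b' c' d' : ℂ} (hv : ∀ a b c d, e.vec a b c d ∈ A.domain →
      conj a * a' - conj b * b' - conj c * c' + conj d * d' = 0) :
    e.vec a' b' c' d' ∈ A.domain := by
  refine fst_mem_domain (y := e.vec' a' b' c' d') (hA.2.mem_graph_iff.2 ?_)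
  intro x y hxy
  obtain ⟨u, v, a, b, c, d, huv, rfl, rfl⟩ := e.exists_add_vec h (graph_le_adjoint h hA hxy)
  have h1 : e.vec a b c d ∈ A.domain := by
    have := sub_mem (fst_mem_domain hxy) (hA.1.1 (fst_mem_domain huv))
    simpa using this
  have h2 := e.green h huv (zero_mem S.graph) a b c d a' b' c' d'
  rw [hv a b c d h1, mul_zero, sub_eq_zero] at h2
  simpa using h2

/-- If the pairs (a, d) did not fill ℂ², a nonzero functional f would vanish on them. The vector
with a, d the conjugated coefficients of f and b = c = 0 is then form-orthogonal to D(A), so belongs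
to D(A); evaluating f there gives a vanishing sum of squares. -/
theorem exists_vec_mem (h : IsJSymmetric J S) (hA : A ∈ jSelfAdjointExtensions J S) (a d : ℂ) :
    ∃ b c, e.vec a b c d ∈ A.domain := by
  let L : Submodule ℂ (ℂ × ℂ) :=
    { carrier := {p | ∃ b c, e.vec p.1 b c p.2 ∈ A.domain}
      zero_mem' := ⟨0, 0, by simp [vec]⟩
      add_mem' := by
        rintro p q ⟨b, c, hp⟩ ⟨b', c', hq⟩
        refine ⟨b + b', c + c', ?_⟩
        convert add_mem hp hq using 1
        simp only [vec, Prod.fst_add, Prod.snd_add]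
        module
      smul_mem' := by
        rintro t p ⟨b, c, hp⟩
        refine ⟨t * b, t * c, ?_⟩
        convert A.domain.smul_mem t hp using 1
        simp only [vec, Prod.smul_fst, Prod.smul_snd, smul_eq_mul]
        module }
  suffices hL : L = ⊤ by
    have : (a, d) ∈ L := by rw [hL]; trivial
    exact this
  by_contra hne
  obtain ⟨f, hf0, hf⟩ := Submodule.exists_le_ker_of_lt_top L (lt_top_iff_ne_top.2 hne)
  have hfe : ∀ a d, f (a, d) = f (1, 0) * a + f (0, 1) * d := by
    intro a d
    have : ((a, d) : ℂ × ℂ) = a • (1, 0) + d • (0, 1) := by simp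
    rw [this, map_add, map_smul, map_smul, smul_eq_mul, smul_eq_mul]
    ring
  have h1 : e.vec (conj (f (1, 0))) 0 0 (conj (f (0, 1))) ∈ A.domain := by
    refine e.vec_mem_of_form h hA fun a b c d hv => ?_
    have h2 : f (a, d) = 0 := hf (show (a, d) ∈ L from ⟨b, c, hv⟩)
    rw [hfe] at h2
    have := congrArg conj h2
    simp only [map_add, map_mul, map_zero] at this
    linear_combination this
  have h3 : f (conj (f (1, 0)), conj (f (0, 1))) = 0 := hf (show _ ∈ L from ⟨0, 0, h1⟩)
  rw [hfe, mul_conj, mul_conj, ← ofReal_add, ofReal_eq_zero,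
    add_eq_zero_iff_of_nonneg (normSq_nonneg _) (normSq_nonneg _), normSq_eq_zero,
    normSq_eq_zero] at h3
  refine hf0 (LinearMap.ext ?_)
  rintro ⟨a, d⟩
  rw [hfe, h3.1, h3.2]
  simp

theorem exists_extension_eq (h : IsJSymmetric J S) (he : e.pp ≠ 0)
    (hA : A ∈ jSelfAdjointExtensions J S) :
    ∃ U ∈ Matrix.unitaryGroup (Fin 2) ℂ, e.extension U = A := by
  obtain ⟨b, c, h1⟩ := e.exists_vec_mem h hA 1 0
  obtain ⟨b', c', h2⟩ := e.exists_vec_mem h hA 0 1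
  have hU : !![b, c; b', c'] ∈ Matrix.unitaryGroup (Fin 2) ℂ := by
    have f₁ := e.form_eq_zero h he hA h1 h1
    have f₂ := e.form_eq_zero h he hA h2 h1
    have f₃ := e.form_eq_zero h he hA h1 h2
    have f₄ := e.form_eq_zero h he hA h2 h2
    simp only [map_one, map_zero] at f₁ f₂ f₃ f₄
    rw [mem_unitaryGroup_two_iff]
    simp only [Matrix.of_apply, Matrix.cons_val', Matrix.cons_val_zero, Matrix.cons_val_one,
      Matrix.cons_val_fin_one]
    refine ⟨?_, ?_, ?_, ?_⟩
    · linear_combination -f₁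
    · linear_combination -f₂
    · linear_combination -f₃
    · linear_combination -f₄
  refine ⟨_, hU, ?_⟩
  have hle : (e.extension !![b, c; b', c']).graph ≤ A.graph := by
    rintro ⟨x, y⟩ hxy
    obtain ⟨u, v, α, δ, huv, rfl, rfl⟩ := (e.mem_graph_extension h _).1 hxy
    refine add_mem (LinearPMap.le_graph_of_le hA.1 huv) (e.mem_graph_of_vec_mem h hA ?_)
    convert add_mem (A.domain.smul_mem α h1) (A.domain.smul_mem δ h2) using 1
    simp only [vec, Matrix.of_apply, Matrix.cons_val', Matrix.cons_val_zero, Matrix.cons_val_one,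
      Matrix.cons_val_fin_one]
    module
  -- Taking adjoints for [·,·] reverses inclusions, so nested J-self-adjoint operators coincide.
  refine LinearPMap.eq_of_eq_graph (le_antisymm hle ?_)
  rintro ⟨x, y⟩ hxy
  rw [(e.extension_mem h he hU).2.mem_graph_iff]
  exact fun u v huv => hA.2.mem_graph_iff.1 hxy u v (hle huv)

theorem bijOn_extension (h : IsJSymmetric J S) (he : e.pp ≠ 0) :
    Set.BijOn e.extension (Matrix.unitaryGroup (Fin 2) ℂ : Set (Matrix (Fin 2) (Fin 2) ℂ))
      (jSelfAdjointExtensions J S) :=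
  ⟨fun _ hU => e.extension_mem h he hU, (e.extension_injective h he).injOn,
    fun _ hA => e.exists_extension_eq h he hA⟩

end DefectBasis

end Extensions

/-! ### Resolvent sets of J-self-adjoint operators -/

section Resolvent

variable {H : Type*} [NormedAddCommGroup H] [InnerProductSpace ℂ H]
  {J : H →L[ℂ] H} {A : H →ₗ.[ℂ] H}

theorem IsJSelfAdjoint.isClosed_graph (hA : IsJSelfAdjoint J A) :
    IsClosed (A.graph : Set (H × H)) := by
  have : (A.graph : Set (H × H)) =
      ⋂ u : A.domain, {p | inner ℂ (J (A u)) p.1 = inner ℂ (J u) p.2} := by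
    ext ⟨x, y⟩
    simp only [SetLike.mem_coe, Set.mem_iInter, Set.mem_ofPred_eq]
    exact hA.2 x y
  rw [this]
  exact isClosed_iInter fun u => isClosed_eq (by fun_prop) (by fun_prop)

/-- A bijective `A - μ` with `A` closed has a bounded inverse. -/
theorem mem_resolventSet_of_bijective [CompleteSpace H] (hA : IsClosed (A.graph : Set (H × H)))
    {μ : ℂ} (hinj : ∀ f, (f, μ • f) ∈ A.graph → f = 0)
    (hsurj : ∀ y, ∃ f g, (f, g) ∈ A.graph ∧ g - μ • f = y) : μ ∈ resolventSet A := by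
  let T : A.domain →ₗ[ℂ] H := A.toFun - μ • A.domain.subtype
  have hT : ∀ x, T x = A x - μ • (x : H) := fun x => rfl
  have hbij : Function.Bijective T := by
    refine ⟨(injective_iff_map_eq_zero T).2 fun x hx => ?_, fun y => ?_⟩
    · have h1 := A.mem_graph x
      rw [hT, sub_eq_zero] at hx
      rw [hx] at h1
      exact Subtype.ext (hinj _ h1)
    · obtain ⟨f, g, h, rfl⟩ := hsurj y
      obtain ⟨x, rfl, rfl⟩ := (LinearPMap.mem_graph_iff _).1 h
      exact ⟨x, hT x⟩
  let E := LinearEquiv.ofBijective T hbij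
  have hE : ∀ x, E x = A x - μ • (x : H) := fun x => rfl
  let R : H →ₗ[ℂ] H := A.domain.subtype ∘ₗ E.symm.toLinearMap
  have hR : ∀ y, R y = (E.symm y : H) := fun y => rfl
  have hgraph : IsClosed (R.graph : Set (H × H)) := by
    have : (R.graph : Set (H × H)) = (fun p : H × H => (p.2, p.1 + μ • p.2)) ⁻¹' A.graph := by
      ext ⟨y, f⟩
      rw [SetLike.mem_coe, LinearMap.mem_graph_iff, Set.mem_preimage, SetLike.mem_coe]
      constructor
      · rintro (rfl : f = R y)
        have h1 := A.mem_graph (E.symm y)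
        have h2 : A (E.symm y) = y + μ • R y := by
          rw [← sub_eq_iff_eq_add, hR, ← hE, E.apply_symm_apply]
        rwa [h2] at h1
      · intro h
        obtain ⟨x, hx, hx'⟩ := (LinearPMap.mem_graph_iff _).1 h
        have h1 : E x = y := by rw [hE, hx', hx]; simp
        change f = R y
        rw [hR, ← h1, E.symm_apply_apply, hx]
    rw [this]
    exact hA.preimage (by fun_prop)
  refine ⟨⟨R, R.continuous_of_isClosed_graph hgraph⟩, fun y => ⟨(E.symm y).2, ?_⟩, fun x => ?_⟩
  · exact E.apply_symm_apply y
  · exact congrArg Subtype.val (E.symm_apply_apply x)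

/-- If R is the resolvent at μ, then J R* J is the resolvent at conj μ. -/
theorem conj_mem_resolventSet [CompleteSpace H] (hJ : IsSelfAdjoint J) (hJ2 : J * J = 1)
    (hA : IsJSelfAdjoint J A) {μ : ℂ} (hμ : μ ∈ resolventSet A) : conj μ ∈ resolventSet A := by
  obtain ⟨R, hR, hR'⟩ := hμ
  let R' : H →L[ℂ] H := J ∘L (ContinuousLinearMap.adjoint R) ∘L J
  have hRe : ∀ y, R' y = J (ContinuousLinearMap.adjoint R (J y)) := fun _ => rfl
  have hgraph : ∀ y, (R' y, y + conj μ • R' y) ∈ A.graph := by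
    intro y
    rw [hA.2]
    intro u
    have h1 : inner ℂ (J (A u - μ • (u : H))) (R' y) = inner ℂ (J u) y := by
      rw [hRe, inner_map_left hJ, map_map_self hJ2, ContinuousLinearMap.adjoint_inner_right, hR',
        inner_map_left hJ]
    rw [map_sub, map_smul, inner_sub_left, inner_smul_left, sub_eq_iff_eq_add] at h1
    rw [h1, inner_add_right, inner_smul_right]
  refine ⟨R', fun y => ?_, fun x => ?_⟩
  · obtain ⟨w, hw, hw'⟩ := (LinearPMap.mem_graph_iff _).1 (hgraph y)
    have hy := fst_mem_domain (hgraph y)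
    have hwe : w = ⟨R' y, hy⟩ := Subtype.ext hw
    refine ⟨hy, ?_⟩
    rw [← hwe, hw']
    simp
  · refine ext_inner_right ℂ fun z => ?_
    obtain ⟨hw, hw'⟩ := hR (J z)
    have h1 := (hA.2 _ _).1 (A.mem_graph ⟨R (J z), hw⟩) x
    rw [hRe, inner_map_left hJ, ContinuousLinearMap.adjoint_inner_left, map_sub, inner_sub_left,
      h1, map_smul, inner_smul_left, conj_conj, ← inner_smul_right, ← inner_sub_right, hw',
      inner_map_left hJ, map_map_self hJ2]

theorem notMem_resolventSet_of_eigenvector {μ : ℂ} {f : H} (hf : (f, μ • f) ∈ A.graph)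
    (hf0 : f ≠ 0) : μ ∉ resolventSet A := by
  rintro ⟨R, -, hR⟩
  obtain ⟨x, rfl, hx⟩ := (LinearPMap.mem_graph_iff _).1 hf
  have := hR x
  simp only at hx
  rw [hx, sub_self, map_zero] at this
  exact hf0 this.symm

/-- If all points of the upper half plane are eigenvalues of a `J`-self-adjoint operator, then its
resolvent set is empty. -/
theorem resolventSet_eq_empty [CompleteSpace H] (hJ : IsSelfAdjoint J) (hJ2 : J * J = 1)
    (hA : IsJSelfAdjoint J A)
    (h : ∀ μ : ℂ, 0 < μ.im → ∃ f, f ≠ 0 ∧ (f, μ • f) ∈ A.graph) : resolventSet A = ∅ := by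
  have hup : ∀ μ : ℂ, 0 < μ.im → μ ∉ resolventSet A := fun μ hμ => by
    obtain ⟨f, hf0, hf⟩ := h μ hμ
    exact notMem_resolventSet_of_eigenvector hf hf0
  refine Set.eq_empty_iff_forall_notMem.2 fun μ hμ => ?_
  rcases lt_trichotomy μ.im 0 with h0 | h0 | h0
  · exact hup (conj μ) (by simpa using h0) (conj_mem_resolventSet hJ hJ2 hA hμ)
  · obtain ⟨R, -, hR⟩ := hμ
    -- An eigenvector x for μ + iε satisfies x = iε R x, hence ε‖R‖ ≥ 1; this ε violates it.
    set ε : ℝ := (‖R‖ + 1)⁻¹ with hε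
    have hpos : 0 < ‖R‖ + 1 := by positivity
    have hεpos : 0 < ε := by positivity
    obtain ⟨f, hf0, hf⟩ := h (μ + ε * I) (by simpa [h0] using hεpos)
    obtain ⟨x, rfl, hx⟩ := (LinearPMap.mem_graph_iff _).1 hf
    simp only at hx
    have h1 := hR x
    rw [hx, add_smul, add_sub_cancel_left, map_smul] at h1
    have h2 : ‖(x : H)‖ ≤ ε * (‖R‖ * ‖(x : H)‖) := by
      conv_lhs => rw [← h1, norm_smul]
      have : ‖(ε : ℂ) * I‖ = ε := by simp [abs_of_pos hεpos]
      rw [this]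
      gcongr
      exact R.le_opNorm _
    have h3 : 0 < ‖(x : H)‖ := norm_pos_iff.2 hf0
    have h4 : ε * (‖R‖ + 1) = 1 := inv_mul_cancel₀ hpos.ne'
    nlinarith [mul_pos hεpos h3]
  · exact hup μ h0 hμ

end Resolvent

/-! ### The characteristic function, N_μ in coordinates, and eigenvalues of A_U -/

section Characteristic

variable {H : Type*} [NormedAddCommGroup H] [InnerProductSpace ℂ H]

theorem ratio_spec {T : H →ₗ.[ℂ] H} {x y : H} (h : ∃ c : ℂ, (x, c • y) ∈ T.graph) :
    (x, ratio T x y • y) ∈ T.graph := by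
  rw [ratio, dif_pos h]
  exact h.choose_spec

theorem mem_graph_cayley {A : H →ₗ.[ℂ] H}
    (hA : ∀ f g, (f, g) ∈ A.graph → g + I • f = 0 → f = 0) {x y : H} :
    (x, y) ∈ (cayley A).graph ↔ ∃ f g, (f, g) ∈ A.graph ∧ g + I • f = x ∧ g - I • f = y := by
  rw [cayley, Submodule.toLinearPMap_graph_eq]
  · simp [-LinearPMap.mem_graph_iff]
  · rintro ⟨x, y⟩ hxy (rfl : x = 0)
    obtain ⟨⟨f, g⟩, hfg, hp⟩ := Submodule.mem_map.1 hxy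
    have h1 : g + I • f = 0 := congrArg Prod.fst hp
    have h2 : g - I • f = y := congrArg Prod.snd hp
    have hf := hA f g hfg h1
    change y = 0
    rw [hf] at h1 h2
    simp only [smul_zero, add_zero, sub_zero] at h1 h2
    rw [← h2, h1]

variable [CompleteSpace H] {J : H →L[ℂ] H} {S : H →ₗ.[ℂ] H}

theorem mem_graph_strausExtension (hdense : Dense (S.domain : Set H))
    (hsymm : S.IsFormalAdjoint S) {μ : ℂ} {x y : H} :
    (x, y) ∈ (strausExtension S μ).graph ↔ ∃ u v n, (u, v) ∈ S.graph ∧ n ∈ defect S μ ∧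
      x = u + n ∧ y = v + μ • n := by
  rw [strausExtension, mem_graph_domRestrict]
  constructor
  · rintro ⟨hx, hxy⟩
    obtain ⟨u, hu, n, hn, rfl⟩ := Submodule.mem_sup.1 hx
    obtain ⟨v, huv⟩ := LinearPMap.mem_domain_iff.1 hu
    exact ⟨u, v, n, huv, hn, rfl, S.adjoint.mem_graph_snd_inj hxy
      (add_mem (mem_adjoint_graph_of_mem hdense hsymm huv) (mem_defect.1 hn)) rfl⟩
  · rintro ⟨u, v, n, huv, hn, rfl, rfl⟩
    exact ⟨Submodule.add_mem_sup (fst_mem_domain huv) hn,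
      add_mem (mem_adjoint_graph_of_mem hdense hsymm huv) (mem_defect.1 hn)⟩

/-- A kernel vector of A_μ + i lies in N_{-i}, so its N_μ-component lies in D(S) + N_{-i} and is
zero. What remains is in D(S), where S + i is injective. -/
theorem strausExtension_add_I_injective (hdense : Dense (S.domain : Set H))
    (hsymm : S.IsFormalAdjoint S) {μ : ℂ} (hμ : 0 < μ.im) (f g : H)
    (hfg : (f, g) ∈ (strausExtension S μ).graph) (h0 : g + I • f = 0) : f = 0 := by
  have hadj : (f, g) ∈ S.adjoint.graph := ((mem_graph_domRestrict _ _ _ _).1 hfg).2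
  obtain ⟨u, v, n, huv, hn, hf, hg⟩ := (mem_graph_strausExtension hdense hsymm).1 hfg
  have hgf : g = -I • f := by rw [neg_smul]; exact eq_neg_of_add_eq_zero_left h0
  have hfd : f ∈ defect S (-I) := by rw [mem_defect, ← hgf]; exact hadj
  have hn' : n = -u + f := by rw [hf]; abel
  have hn0 : n = 0 := by
    rw [hn'] at hn ⊢
    exact defect_eq_zero_of_upper hdense hsymm hμ (neg_mem (fst_mem_domain huv)) hfd hn
  rw [hn0, add_zero] at hf
  rw [hn0, smul_zero, add_zero] at hg
  subst hf hg
  have h1 := norm_sq_add_I_smul hsymm huv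
  rw [h0, norm_zero] at h1
  have : ‖f‖ ^ 2 = 0 := by nlinarith [sq_nonneg ‖f‖, sq_nonneg ‖g‖]
  simpa using this

theorem mem_graph_Sh (hdense : Dense (S.domain : Set H)) (hsymm : S.IsFormalAdjoint S) {μ : ℂ}
    (hμ : 0 < μ.im) {a b : H} (ha : a ∈ defect S I) (hb : b ∈ defect S (-I)) :
    (a, b) ∈ (Sh S μ).graph ↔ ∃ u ∈ S.domain, u + a - b ∈ defect S μ := by
  rw [Sh, mem_graph_domRestrict,
    mem_graph_cayley (strausExtension_add_I_injective hdense hsymm hμ)]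
  have hI : (2 * I) ≠ (0 : ℂ) := by simp
  constructor
  · rintro ⟨-, f, g, hfg, rfl, rfl⟩
    obtain ⟨u, v, n, huv, hn, rfl, rfl⟩ := (mem_graph_strausExtension hdense hsymm).1 hfg
    refine ⟨-(2 * I) • u, Submodule.smul_mem _ _ (fst_mem_domain huv), ?_⟩
    convert Submodule.smul_mem _ (2 * I) hn using 1
    module
  · rintro ⟨u, hu, hm⟩
    obtain ⟨v, huv⟩ := LinearPMap.mem_domain_iff.1 hu
    have h1 : v + I • a - -I • b = μ • (u + a - b) :=
      S.adjoint.mem_graph_snd_inj (sub_mem (add_mem (mem_adjoint_graph_of_mem hdense hsymm huv)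
        (mem_defect.1 ha)) (mem_defect.1 hb)) (mem_defect.1 hm) rfl
    -- These are the solutions f, g of g + i f = a and g - i f = b.
    refine ⟨ha, (2 * I)⁻¹ • (a - b), (1 / 2 : ℂ) • (a + b), ?_, ?_, ?_⟩
    · refine (mem_graph_strausExtension hdense hsymm).2 ⟨(2 * I)⁻¹ • (-u), (2 * I)⁻¹ • (-v),
        (2 * I)⁻¹ • (u + a - b), S.graph.smul_mem _ (neg_mem huv), Submodule.smul_mem _ _ hm,
        by module, ?_⟩
      rw [smul_comm μ, ← h1]
      simp only [mul_inv, inv_I]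
      match_scalars <;> ring_nf <;> norm_num
    · rw [smul_smul]
      have : I * (2 * I)⁻¹ = 1 / 2 := by field_simp
      rw [this]; module
    · rw [smul_smul]
      have : I * (2 * I)⁻¹ = 1 / 2 := by field_simp
      rw [this]; module

namespace DefectBasis

variable (e : DefectBasis J S)

theorem finiteDimensional_defect_I (e : DefectBasis J S) (h : IsJSymmetric J S) :
    FiniteDimensional ℂ (defect S I) := by
  have hle : defect S I ≤ Submodule.span ℂ {e.pp, e.pm} := by
    intro x hx
    obtain ⟨a, b, rfl⟩ := e.exists_defect_I h hx
    exact Submodule.mem_span_pair.2 ⟨a, b, rfl⟩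
  have : FiniteDimensional ℂ (Submodule.span ℂ {e.pp, e.pm}) :=
    FiniteDimensional.span_of_finite ℂ (Set.toFinite _)
  exact Submodule.finiteDimensional_of_le hle

theorem finrank_defect_neg_I (e : DefectBasis J S) (h : IsJSymmetric J S) :
    FiniteDimensional ℂ (defect S (-I)) ∧ Module.finrank ℂ (defect S (-I)) ≤ 2 := by
  classical
  have hle : defect S (-I) ≤ Submodule.span ℂ ({e.mp, e.mm} : Finset H) := by
    intro x hx
    obtain ⟨a, b, rfl⟩ := e.exists_defect_neg_I h hx
    rw [Finset.coe_pair]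
    exact Submodule.mem_span_pair.2 ⟨a, b, rfl⟩
  exact ⟨Submodule.finiteDimensional_of_le hle, (Submodule.finrank_mono hle).trans
    ((finrank_span_finset_le_card _).trans Finset.card_le_two)⟩

/-- Averaging the element of N_μ over e₊₊ with its image under J removes the e₋₋-component. Thus the
default value of `ratio` never occurs in the upper half plane. -/
theorem mem_graph_Sh_pp (h : IsJSymmetric J S) {μ : ℂ} (hμ : 0 < μ.im) :
    (e.pp, e.sPlus μ • e.mp) ∈ (Sh S μ).graph := by
  have := e.finiteDimensional_defect_I h
  refine ratio_spec ?_
  obtain ⟨hJ, hd⟩ := e.mem_pp h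
  obtain ⟨u, hu, b, hb, hm⟩ := exists_add_sub_mem_defect h.dense h.closed h.symm hμ hd
  have hb' := Submodule.smul_mem _ (1 / 2 : ℂ) (add_mem hb (h.map_mem_defect hb))
  obtain ⟨c, hc⟩ := e.exists_smul_mp h hb' (h.map_half_add b)
  refine ⟨c, ?_⟩
  rw [hc, mem_graph_Sh h.dense h.symm hμ hd hb']
  refine ⟨(1 / 2 : ℂ) • (u + J u), Submodule.smul_mem _ _ (add_mem hu ((h.comm.1 u).2 hu)), ?_⟩
  convert Submodule.smul_mem _ (1 / 2 : ℂ) (add_mem hm (h.map_mem_defect hm)) using 1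
  rw [map_sub, map_add, hJ]
  module

theorem mem_graph_Sh_pm (h : IsJSymmetric J S) {μ : ℂ} (hμ : 0 < μ.im) :
    (e.pm, e.sMinus μ • e.mm) ∈ (Sh S μ).graph := by
  have := e.finiteDimensional_defect_I h
  refine ratio_spec ?_
  obtain ⟨hJ, hd⟩ := e.mem_pm h
  obtain ⟨u, hu, b, hb, hm⟩ := exists_add_sub_mem_defect h.dense h.closed h.symm hμ hd
  have hb' := Submodule.smul_mem _ (1 / 2 : ℂ) (sub_mem hb (h.map_mem_defect hb))
  obtain ⟨c, hc⟩ := e.exists_smul_mm h hb' (h.map_half_sub b)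
  refine ⟨c, ?_⟩
  rw [hc, mem_graph_Sh h.dense h.symm hμ hd hb']
  refine ⟨(1 / 2 : ℂ) • (u - J u), Submodule.smul_mem _ _ (sub_mem hu ((h.comm.1 u).2 hu)), ?_⟩
  convert Submodule.smul_mem _ (1 / 2 : ℂ) (sub_mem hm (h.map_mem_defect hm)) using 1
  rw [map_sub, map_add, hJ]
  module

/-- `N_μ` in coordinates. -/
theorem exists_add_vec_mem_defect (h : IsJSymmetric J S) {μ : ℂ} (hμ : 0 < μ.im) (a b : ℂ) :
    ∃ u ∈ S.domain, u + e.vec a b (-(a * e.sPlus μ)) (-(b * e.sMinus μ)) ∈ defect S μ := by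
  obtain ⟨u, hu, h1⟩ := (mem_graph_Sh h.dense h.symm hμ (e.mem_pp h).2
    (Submodule.smul_mem _ _ (e.mem_mp h).2)).1 (e.mem_graph_Sh_pp h hμ)
  obtain ⟨u', hu', h2⟩ := (mem_graph_Sh h.dense h.symm hμ (e.mem_pm h).2
    (Submodule.smul_mem _ _ (e.mem_mm h).2)).1 (e.mem_graph_Sh_pm h hμ)
  refine ⟨a • u + b • u', add_mem (Submodule.smul_mem _ _ hu) (Submodule.smul_mem _ _ hu'), ?_⟩
  convert add_mem (Submodule.smul_mem _ a h1) (Submodule.smul_mem _ b h2) using 1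
  rw [vec]; module

/-- Two elements of N_μ with the same a, b differ by an element of D(S) + N_{-i}, which must vanish.
-/
theorem eq_of_add_vec_mem_defect (h : IsJSymmetric J S) (he : e.pp ≠ 0) {μ : ℂ} (hμ : 0 < μ.im)
    {u : H} (hu : u ∈ S.domain) {a b c d : ℂ} (hm : u + e.vec a b c d ∈ defect S μ) :
    c = -(a * e.sPlus μ) ∧ d = -(b * e.sMinus μ) := by
  obtain ⟨u', hu', hm'⟩ := e.exists_add_vec_mem_defect h hμ a b
  have h1 : (u - u') + e.vec 0 0 (c - -(a * e.sPlus μ)) (d - -(b * e.sMinus μ)) ∈ defect S μ := by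
    convert sub_mem hm hm' using 1
    simp only [vec]; module
  have h2 : e.vec 0 0 (c - -(a * e.sPlus μ)) (d - -(b * e.sMinus μ)) ∈ defect S (-I) := by
    rw [vec, zero_smul, zero_smul, add_zero, zero_add]
    exact add_mem (Submodule.smul_mem _ _ (e.mem_mp h).2) (Submodule.smul_mem _ _ (e.mem_mm h).2)
  have h3 := defect_eq_zero_of_upper h.dense h.symm hμ (sub_mem hu hu') h2 h1
  obtain ⟨-, -, h4, h5⟩ := e.add_vec_eq_zero h he (sub_mem hu hu') h3
  exact ⟨sub_eq_zero.1 h4, sub_eq_zero.1 h5⟩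

theorem sPlus_I (h : IsJSymmetric J S) (he : e.pp ≠ 0) : e.sPlus I = 0 := by
  have h1 : (0 : H) + e.vec 1 0 0 0 ∈ defect S I := by simpa [vec] using (e.mem_pp h).2
  simpa using (e.eq_of_add_vec_mem_defect h he (by simp) (zero_mem _) h1).1

theorem sMinus_I (h : IsJSymmetric J S) (he : e.pp ≠ 0) : e.sMinus I = 0 := by
  have h1 : (0 : H) + e.vec 0 1 0 0 ∈ defect S I := by simpa [vec] using (e.mem_pm h).2
  simpa using (e.eq_of_add_vec_mem_defect h he (by simp) (zero_mem _) h1).2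

theorem shIsZero_iff (h : IsJSymmetric J S) (he : e.pp ≠ 0) :
    ShIsZero S ↔ ∀ μ : ℂ, 0 < μ.im → e.sPlus μ = 0 ∧ e.sMinus μ = 0 := by
  have hn : ‖e.pp‖ ≠ 0 := norm_ne_zero_iff.2 he
  have hmp : e.mp ≠ 0 := norm_ne_zero_iff.1 (by rwa [e.norm_mp])
  have hmm : e.mm ≠ 0 := norm_ne_zero_iff.1 (by rwa [e.norm_mm])
  constructor
  · intro h0 μ hμ
    constructor
    · obtain ⟨x, -, hx⟩ := (LinearPMap.mem_graph_iff _).1 (e.mem_graph_Sh_pp h hμ)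
      rw [h0 μ hμ] at hx
      simpa [hmp] using hx.symm
    · obtain ⟨x, -, hx⟩ := (LinearPMap.mem_graph_iff _).1 (e.mem_graph_Sh_pm h hμ)
      rw [h0 μ hμ] at hx
      simpa [hmm] using hx.symm
  · intro h0 μ hμ x
    obtain ⟨a, b, hx⟩ := e.exists_defect_I h (x := x) x.2.1
    have h1 := e.mem_graph_Sh_pp h hμ
    have h2 := e.mem_graph_Sh_pm h hμ
    rw [(h0 μ hμ).1, zero_smul] at h1
    rw [(h0 μ hμ).2, zero_smul] at h2
    have h3 := add_mem (Submodule.smul_mem _ a h1) (Submodule.smul_mem _ b h2)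
    simp only [Prod.smul_mk, Prod.mk_add_mk, smul_zero, add_zero] at h3
    exact (Sh S μ).mem_graph_snd_inj ((Sh S μ).mem_graph x) h3 hx

/-- An eigenvector of `A_U` in coordinates. -/
theorem eigenvector_coordinates (h : IsJSymmetric J S) (he : e.pp ≠ 0)
    {U : Matrix (Fin 2) (Fin 2) ℂ} {μ : ℂ} (hμ : 0 < μ.im) {f : H} (hf0 : f ≠ 0)
    (hf : (f, μ • f) ∈ (e.extension U).graph) :
    ∃ α δ : ℂ, (α ≠ 0 ∨ α * U 0 0 + δ * U 1 0 ≠ 0) ∧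
      α * U 0 1 + δ * U 1 1 = -(α * e.sPlus μ) ∧
      δ = -((α * U 0 0 + δ * U 1 0) * e.sMinus μ) := by
  have hfd : f ∈ defect S μ := ((mem_graph_domRestrict _ _ _ _).1 hf).2
  obtain ⟨u, v, α, δ, huv, hfe, -⟩ := (e.mem_graph_extension h U).1 hf
  have h1 := hfd
  rw [hfe] at h1
  obtain ⟨h2, h3⟩ := e.eq_of_add_vec_mem_defect h he hμ (fst_mem_domain huv) h1
  refine ⟨α, δ, ?_, h2, h3⟩
  by_contra! h4
  rw [h4.2, zero_mul, neg_zero] at h3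
  rw [h4.1, h3] at hfe
  have h5 : f = u + 0 := by rw [hfe]; simp [vec]
  rw [h5] at hfd hf0
  exact hf0 (defect_eq_zero_of_upper h.dense h.symm hμ (fst_mem_domain huv) (zero_mem _) hfd)

/-- Points of the upper half plane that are not eigenvalues of `A_U` belong to its resolvent
set. -/
theorem mem_resolventSet_extension (h : IsJSymmetric J S) (he : e.pp ≠ 0)
    {U : Matrix (Fin 2) (Fin 2) ℂ} (hU : U ∈ Matrix.unitaryGroup (Fin 2) ℂ) {μ : ℂ}
    (hμ : 0 < μ.im) (hinj : ∀ f, (f, μ • f) ∈ (e.extension U).graph → f = 0) :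
    μ ∈ resolventSet (e.extension U) := by
  refine mem_resolventSet_of_bijective (e.extension_mem h he hU).2.isClosed_graph hinj ?_
  obtain ⟨hfin, hrank⟩ := e.finrank_defect_neg_I h
  obtain ⟨hfin', hrank'⟩ := finrank_defect_le_of_lower h.dense h.closed h.symm (μ := conj μ)
    (by simpa using hμ)
  set A := e.extension U with hA
  have hSA : ∀ {u v : H}, (u, v) ∈ S.graph → (u, v) ∈ A.graph :=
    fun huv => LinearPMap.le_graph_of_le (e.le_extension h U) huv
  let W : ℂ × ℂ →ₗ[ℂ] H :=
    (LinearMap.fst ℂ ℂ ℂ).smulRight (e.vec' 1 (U 0 0) (U 0 1) 0 - μ • e.vec 1 (U 0 0) (U 0 1) 0) +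
    (LinearMap.snd ℂ ℂ ℂ).smulRight (e.vec' 0 (U 1 0) (U 1 1) 1 - μ • e.vec 0 (U 1 0) (U 1 1) 1)
  have hW : ∀ p : ℂ × ℂ, ∃ x y, (x, y) ∈ A.graph ∧ y - μ • x = W p ∧
      x = e.vec p.1 (p.1 * U 0 0 + p.2 * U 1 0) (p.1 * U 0 1 + p.2 * U 1 1) p.2 := by
    rintro ⟨α, δ⟩
    refine ⟨_, e.vec' α (α * U 0 0 + δ * U 1 0) (α * U 0 1 + δ * U 1 1) δ, ?_, ?_, rfl⟩
    · exact (e.mem_graph_extension h U).2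
        ⟨0, 0, α, δ, zero_mem S.graph, (zero_add _).symm, (zero_add _).symm⟩
    · change _ = α • (e.vec' 1 (U 0 0) (U 0 1) 0 - μ • e.vec 1 (U 0 0) (U 0 1) 0) +
        δ • (e.vec' 0 (U 1 0) (U 1 1) 1 - μ • e.vec 0 (U 1 0) (U 1 1) 1)
      simp only [vec, vec']
      module
  -- P is A_U - μ on M, taken modulo ran(S - μ), whose orthogonal complement is N_{conj μ}.
  let P : ℂ × ℂ →ₗ[ℂ] defect S (conj μ) :=
    (defect S (conj μ)).orthogonalProjectionOnto.toLinearMap ∘ₗ W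
  have hdec : ∀ p, ∃ u v, (u, v) ∈ S.graph ∧ W p = v - μ • u + (P p : H) := by
    intro p
    obtain ⟨u, v, n, huv, hn, hp⟩ :=
      exists_sub_smul_add_defect h.dense h.closed h.symm hμ.ne' (W p)
    refine ⟨u, v, huv, ?_⟩
    have h0 : (defect S (conj μ)).orthogonalProjectionOnto (v - μ • u) = 0 := by
      rw [Submodule.orthogonalProjectionOnto_eq_zero_iff, Submodule.mem_orthogonal']
      exact fun m hm => inner_sub_smul_defect h.dense huv hm
    have h1 : P p = ⟨n, hn⟩ := by
      change (defect S (conj μ)).orthogonalProjectionOnto (W p) = _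
      rw [hp, map_add, h0, zero_add]
      exact Submodule.orthogonalProjectionOnto_mem_subspace_eq_self (K := defect S (conj μ)) ⟨n, hn⟩
    rw [h1]
    exact hp
  -- If P p = 0, the vector of M given by p differs from some u ∈ D(S) by a solution of (A_U - μ)f =
  -- 0. Hence it equals u, and its coordinates vanish.
  have hP : Function.Injective P := by
    rw [injective_iff_map_eq_zero]
    intro p hp
    obtain ⟨u, v, huv, h1⟩ := hdec p
    obtain ⟨x, y, hxy, h2, h3⟩ := hW p
    rw [hp, Submodule.coe_zero, add_zero, ← h2] at h1
    have h4 := sub_mem hxy (hSA huv)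
    have h5 : y - v = μ • (x - u) := by rw [smul_sub, sub_eq_sub_iff_sub_eq_sub, h1]
    rw [Prod.mk_sub_mk, h5] at h4
    have h6 : -u + e.vec p.1 (p.1 * U 0 0 + p.2 * U 1 0) (p.1 * U 0 1 + p.2 * U 1 1) p.2 = 0 := by
      rw [← h3, ← hinj _ h4]; abel
    obtain ⟨h7, -, -, h8⟩ := e.add_vec_eq_zero h he (neg_mem (fst_mem_domain huv)) h6
    exact Prod.ext h7 h8
  -- Injectivity gives dim N_{conj μ} ≥ 2, and dim N_{conj μ} ≤ dim N_{-i} ≤ 2, so P is onto.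
  have hPs : Function.Surjective P := by
    refine (LinearMap.injective_iff_surjective_of_finrank_eq_finrank (le_antisymm ?_ ?_)).1 hP
    · exact LinearMap.finrank_le_finrank_of_injective hP
    · simpa using hrank'.trans hrank
  intro y
  obtain ⟨u, v, n, huv, hn, rfl⟩ :=
    exists_sub_smul_add_defect h.dense h.closed h.symm hμ.ne' y
  obtain ⟨p, hp⟩ := hPs ⟨n, hn⟩
  obtain ⟨u', v', huv', h1⟩ := hdec p
  obtain ⟨x, y, hxy, h2, -⟩ := hW p
  rw [hp, ← h2] at h1
  refine ⟨u + (x - u'), v + (y - v'), add_mem (hSA huv) (sub_mem hxy (hSA huv')), ?_⟩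
  linear_combination (norm := module) h1

theorem resolventSet_extension_eq_empty_iff (h : IsJSymmetric J S) (he : e.pp ≠ 0)
    {U : Matrix (Fin 2) (Fin 2) ℂ} (hU : U ∈ Matrix.unitaryGroup (Fin 2) ℂ) :
    resolventSet (e.extension U) = ∅ ↔ U 0 1 = 0 ∧ U 1 0 = 0 ∧
      ∀ μ : ℂ, 0 < μ.im → e.sPlus μ = U 0 0 * U 1 1 * e.sMinus μ := by
  constructor
  · intro h0
    have hev : ∀ μ : ℂ, 0 < μ.im → ∃ f, f ≠ 0 ∧ (f, μ • f) ∈ (e.extension U).graph := by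
      intro μ hμ
      by_contra! hno
      have := e.mem_resolventSet_extension h he hU hμ
        fun f hf => by_contra fun hf0 => hno f hf0 hf
      rw [h0] at this
      exact this
    -- At μ = i both s₊ and s₋ vanish, so an eigenvector has δ = 0, α ≠ 0 and α U₁₂ = 0.
    have h01 : U 0 1 = 0 := by
      obtain ⟨f, hf0, hf⟩ := hev I (by simp)
      obtain ⟨α, δ, hne, h1, h2⟩ := e.eigenvector_coordinates h he (by simp) hf0 hf
      rw [e.sMinus_I h he, mul_zero, neg_zero] at h2
      rw [e.sPlus_I h he, h2] at h1
      rw [h2] at hne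
      simp only [zero_mul, add_zero, mul_zero, neg_zero, mul_eq_zero] at h1
      refine h1.resolve_left fun hα => ?_
      simp [hα] at hne
    have h10 : U 1 0 = 0 := by
      obtain ⟨-, r₂, -, -⟩ := mem_unitaryGroup_two_iff.1 hU
      obtain ⟨c₁, -, -, -⟩ := unitaryGroup_two_columns hU
      obtain ⟨r₁, -, -, -⟩ := mem_unitaryGroup_two_iff.1 hU
      rw [h01] at r₁ r₂
      simp only [zero_mul, add_zero] at r₁ r₂
      have hne : U 0 0 ≠ 0 := by
        intro h00
        simp [h00] at r₁
      simpa [hne] using r₂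
    refine ⟨h01, h10, fun μ hμ => ?_⟩
    obtain ⟨f, hf0, hf⟩ := hev μ hμ
    obtain ⟨α, δ, hne, h1, h2⟩ := e.eigenvector_coordinates h he hμ hf0 hf
    rw [h10, mul_zero, add_zero] at hne h2
    rw [h01, mul_zero, zero_add] at h1
    have hα : α ≠ 0 := by
      rintro rfl
      simp at hne
    refine mul_left_cancel₀ hα ?_
    linear_combination h1 - U 1 1 * h2
  · rintro ⟨h01, h10, hs⟩
    refine resolventSet_eq_empty h.selfAdjoint h.sq (e.extension_mem h he hU).2 fun μ hμ => ?_
    -- The element of N_μ with a = 1, b = U₁₁ has d = -U₁₁ s₋; the relation between s₊ and s₋ is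
    -- exactly c = d U₂₂, so it lies in D(S) + M.
    obtain ⟨u, hu, hm⟩ := e.exists_add_vec_mem_defect h hμ 1 (U 0 0)
    refine ⟨_, ?_, (mem_graph_domRestrict _ _ _ _).2 ⟨?_, mem_defect.1 hm⟩⟩
    · intro h0
      exact one_ne_zero (e.add_vec_eq_zero h he hu h0).1
    · refine Submodule.add_mem_sup hu
        (Submodule.mem_span_pair.2 ⟨1, -(U 0 0 * e.sMinus μ), ?_⟩)
      rw [h01, h10, vec, hs μ hμ]
      module

end DefectBasis

end Characteristic

/-! ### Diagonal unitary matrices and the phase φ -/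

section Diagonal

theorem exists_Ico_exp_eq {z : ℂ} (hz : ‖z‖ = 1) :
    ∃ γ ∈ Set.Ico 0 (2 * Real.pi), exp (γ * I) = z := by
  refine ⟨toIcoMod Real.two_pi_pos 0 (arg z),
    by simpa using toIcoMod_mem_Ico Real.two_pi_pos 0 _, ?_⟩
  have h1 := norm_mul_exp_arg_mul_I z
  rw [hz, ofReal_one, one_mul] at h1
  conv_rhs => rw [← h1]
  rw [exp_eq_exp_iff_exists_int]
  refine ⟨-toIcoDiv Real.two_pi_pos 0 (arg z), ?_⟩
  rw [toIcoMod]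
  push_cast
  simp only [zsmul_eq_mul]
  ring

theorem diagU_entries (φ γ : ℝ) : diagU φ γ 0 0 = exp (φ * I) * exp (γ * I) ∧
    diagU φ γ 0 1 = 0 ∧ diagU φ γ 1 0 = 0 ∧ diagU φ γ 1 1 = exp (φ * I) * exp (-γ * I) := by
  simp [diagU]

theorem diagU_mul (φ γ : ℝ) : diagU φ γ 0 0 * diagU φ γ 1 1 = exp (2 * φ * I) := by
  obtain ⟨h1, -, -, h2⟩ := diagU_entries φ γ
  rw [h1, h2, ← exp_add, ← exp_add, ← exp_add]
  congr 1
  ring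

/-- A diagonal unitary matrix of determinant `e^{2iφ}` is of the form
`e^{iφ} diag(e^{iγ}, e^{-iγ})`. -/
theorem exists_eq_diagU {U : Matrix (Fin 2) (Fin 2) ℂ} (h01 : U 0 1 = 0) (h10 : U 1 0 = 0)
    (h00 : ‖U 0 0‖ = 1) {φ : ℝ} (hφ : U 0 0 * U 1 1 = exp (2 * φ * I)) :
    ∃ γ ∈ Set.Ico 0 (2 * Real.pi), U = diagU φ γ := by
  obtain ⟨γ, hγ, hγe⟩ := exists_Ico_exp_eq (z := exp (-φ * I) * U 0 0) (by
    rw [norm_mul, h00, mul_one, ← ofReal_neg, norm_exp_ofReal_mul_I])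
  obtain ⟨d1, d2, d3, d4⟩ := diagU_entries φ γ
  have e1 : diagU φ γ 0 0 = U 0 0 := by
    rw [d1, hγe, ← mul_assoc, ← exp_add]
    simp
  have hne : U 0 0 ≠ 0 := norm_ne_zero_iff.1 (by rw [h00]; exact one_ne_zero)
  have e2 : diagU φ γ 1 1 = U 1 1 := by
    refine mul_left_cancel₀ hne ?_
    rw [hφ, ← e1, diagU_mul]
  refine ⟨γ, hγ, ?_⟩
  ext i j
  fin_cases i <;> fin_cases j
  · exact e1.symm
  · exact h01.trans d2.symm
  · exact h10.trans d3.symm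
  · exact e2.symm

theorem norm_diagonal_of_unitary {U : Matrix (Fin 2) (Fin 2) ℂ}
    (hU : U ∈ Matrix.unitaryGroup (Fin 2) ℂ) (h01 : U 0 1 = 0) (h10 : U 1 0 = 0) :
    ‖U 0 0‖ = 1 ∧ ‖U 1 1‖ = 1 := by
  obtain ⟨r₁, -, -, r₄⟩ := mem_unitaryGroup_two_iff.1 hU
  rw [h01, zero_mul, add_zero, mul_conj'] at r₁
  rw [h10, zero_mul, zero_add, mul_conj'] at r₄
  norm_cast at r₁ r₄
  exact ⟨(pow_eq_one_iff_of_nonneg (norm_nonneg _) two_ne_zero).1 r₁,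
    (pow_eq_one_iff_of_nonneg (norm_nonneg _) two_ne_zero).1 r₄⟩

end Diagonal

namespace DefectBasis

variable {H : Type*} [NormedAddCommGroup H] [InnerProductSpace ℂ H] [CompleteSpace H]
  {J : H →L[ℂ] H} {S : H →ₗ.[ℂ] H} (e : DefectBasis J S)

theorem exists_phaseRelation (hs : e.SApprox) :
    ∃ φ ∈ Set.Ico 0 Real.pi, e.PhaseRelation φ := by
  obtain ⟨α, hα⟩ := hs
  -- Only e^{2iφ} = e^{-iα} matters, so -α/2 may be reduced modulo π.
  refine ⟨toIcoMod Real.pi_pos 0 (-α / 2), by simpa using toIcoMod_mem_Ico Real.pi_pos 0 _,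
    fun μ hμ => ?_⟩
  have h1 : exp (2 * (toIcoMod Real.pi_pos 0 (-α / 2) : ℝ) * I) = exp (-(α * I)) := by
    rw [exp_eq_exp_iff_exists_int]
    refine ⟨-toIcoDiv Real.pi_pos 0 (-α / 2), ?_⟩
    rw [toIcoMod]
    push_cast
    simp only [zsmul_eq_mul]
    ring
  rw [h1, ← hα μ hμ, ← mul_assoc, ← exp_add, neg_add_cancel, exp_zero, one_mul]

/-- Supplies a point where s₋ can be cancelled, turning relations between functions into relations
between constants. -/
theorem exists_sMinus_ne_zero (h : IsJSymmetric J S) (he : e.pp ≠ 0) (hs : e.SApprox)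
    (hSh : ¬ ShIsZero S) : ∃ μ : ℂ, 0 < μ.im ∧ e.sMinus μ ≠ 0 := by
  by_contra! hno
  refine hSh ((e.shIsZero_iff h he).2 fun μ hμ => ⟨?_, hno μ hμ⟩)
  obtain ⟨φ, -, hφ⟩ := e.exists_phaseRelation hs
  rw [← hφ μ hμ, hno μ hμ, mul_zero]

theorem phaseRelation_unique {μ : ℂ} (hμ : 0 < μ.im) (hne : e.sMinus μ ≠ 0) {φ ψ : ℝ}
    (hφ : φ ∈ Set.Ico 0 Real.pi) (hψ : ψ ∈ Set.Ico 0 Real.pi) (h1 : e.PhaseRelation φ)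
    (h2 : e.PhaseRelation ψ) : φ = ψ := by
  have h3 := mul_right_cancel₀ hne ((h1 μ hμ).trans (h2 μ hμ).symm)
  obtain ⟨n, hn⟩ := exp_eq_exp_iff_exists_int.1 h3
  have h4 : φ = ψ + n * Real.pi := by
    have h5 : (2 * I) * (φ : ℂ) = (2 * I) * ((ψ + n * Real.pi : ℝ) : ℂ) := by
      push_cast
      linear_combination hn
    exact_mod_cast mul_left_cancel₀ (by simp) h5
  have hpi := Real.pi_pos
  have h6 : (n : ℝ) < 1 := by
    by_contra! hc
    nlinarith [hφ.2, hψ.1]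
  have h7 : (-1 : ℝ) < n := by
    by_contra! hc
    nlinarith [hφ.1, hψ.2]
  have h8 : n = 0 := by
    have h9 : n < 1 := by exact_mod_cast h6
    have h10 : -1 < n := by exact_mod_cast h7
    omega
  rw [h4, h8]
  simp

end DefectBasis

end JExt

end

/-! ### The description of the extensions with empty resolvent set -/

theorem corollary3p2 {H : Type*} [NormedAddCommGroup H] [InnerProductSpace ℂ H] [CompleteSpace H]
    (J : H →L[ℂ] H) (hJ : JExt.IsFundamentalSymmetry J)
    (S : H →ₗ.[ℂ] H) (hdense : Dense (S.domain : Set H)) (hclosed : S.IsClosed)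
    (hsymm : S.IsFormalAdjoint S) (hcomm : JExt.CommutesWith S J)
    (hplus : JExt.HasDeficiencyIndices (JExt.part S (JExt.posSubspace J)) 1 1)
    (hminus : JExt.HasDeficiencyIndices (JExt.part S (JExt.negSubspace J)) 1 1)
    (e : JExt.DefectBasis J S) (hs : e.SApprox) :
    Set.BijOn e.extension (Matrix.unitaryGroup (Fin 2) ℂ : Set (Matrix (Fin 2) (Fin 2) ℂ))
        (JExt.jSelfAdjointExtensions J S) ∧
    (¬ JExt.ShIsZero S →
      (∃! φ : ℝ, φ ∈ Set.Ico 0 Real.pi ∧ e.PhaseRelation φ) ∧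
      ∀ φ : ℝ, e.PhaseRelation φ → ∀ U ∈ Matrix.unitaryGroup (Fin 2) ℂ,
        (JExt.resolventSet (e.extension U) = ∅ ↔
          ∃ γ ∈ Set.Ico 0 (2 * Real.pi), U = JExt.diagU φ γ)) ∧
    (JExt.ShIsZero S → ∀ U ∈ Matrix.unitaryGroup (Fin 2) ℂ,
      (JExt.resolventSet (e.extension U) = ∅ ↔
        ∃ φ ∈ Set.Ico 0 (2 * Real.pi), ∃ γ ∈ Set.Ico 0 (2 * Real.pi), U = JExt.diagU φ γ)) := by
  have h : JExt.IsJSymmetric J S := ⟨hJ.selfAdjoint, hJ.sq, hdense, hclosed, hsymm, hcomm⟩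
  have he := e.pp_ne_zero hplus
  refine ⟨e.bijOn_extension h he, fun hSh => ⟨?_, fun φ hφ U hU => ?_⟩, fun hSh U hU => ?_⟩
  · obtain ⟨μ, hμ, hne⟩ := e.exists_sMinus_ne_zero h he hs hSh
    obtain ⟨φ, hφ, hφr⟩ := e.exists_phaseRelation hs
    exact ⟨φ, ⟨hφ, hφr⟩, fun ψ hψ => e.phaseRelation_unique hμ hne hψ.1 hφ hψ.2 hφr⟩
  · rw [e.resolventSet_extension_eq_empty_iff h he hU]
    constructor
    · rintro ⟨h01, h10, hsU⟩
      obtain ⟨μ, hμ, hne⟩ := e.exists_sMinus_ne_zero h he hs hSh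
      exact JExt.exists_eq_diagU h01 h10 (JExt.norm_diagonal_of_unitary hU h01 h10).1
        (mul_right_cancel₀ hne ((hsU μ hμ).symm.trans (hφ μ hμ).symm))
    · rintro ⟨γ, -, rfl⟩
      obtain ⟨-, d01, d10, -⟩ := JExt.diagU_entries φ γ
      refine ⟨d01, d10, fun μ hμ => ?_⟩
      rw [JExt.diagU_mul, hφ μ hμ]
  · rw [e.resolventSet_extension_eq_empty_iff h he hU]
    constructor
    · rintro ⟨h01, h10, -⟩
      obtain ⟨n0, n1⟩ := JExt.norm_diagonal_of_unitary hU h01 h10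
      obtain ⟨ψ, hψ, hψe⟩ := JExt.exists_Ico_exp_eq (z := U 0 0 * U 1 1) (by
        rw [norm_mul, n0, n1, one_mul])
      -- Here the determinant is free: φ is half of its argument ψ ∈ [0, 2π).
      refine ⟨ψ / 2, ⟨by linarith [hψ.1], by linarith [hψ.1, hψ.2]⟩,
        JExt.exists_eq_diagU h01 h10 n0 ?_⟩
      rw [← hψe]
      congr 1
      push_cast
      ring
    · rintro ⟨φ, -, γ, -, rfl⟩
      obtain ⟨-, d01, d10, -⟩ := JExt.diagU_entries φ γ
      refine ⟨d01, d10, fun μ hμ => ?_⟩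
      obtain ⟨s1, s2⟩ := (e.shIsZero_iff h he).1 hSh μ hμ
      rw [s1, s2, mul_zero]
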